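/- Let $n,m$ be coprime integers with $0<m<n$, $n$ odd and $2n+m$ divisible by $6$. Let $b\ge 1$ be the real number with $\frac{1+\sqrt{1+8b^3}}{4b^3}=\frac mn$ (equivalently $2b^3=\frac{n(n+m)}{m^2}$), let $r>0$ with $r^2=\frac{n(n+2m)}{2b^2m^2}$, and let $p\in[0,1)$ with $p^2=\frac{n^2-m^2}{n(n+2m)}$. Put $$K=\int_0^{\pi/2}\frac{d\theta}{\sqrt{1-p^2\sin^2\theta}},\qquad E=\int_0^{\pi/2}\sqrt{1-p^2\sin^2\theta}\,d\theta,$$ and let $\mathrm{sn},\mathrm{cn},\mathrm{dn}$ be the Jacobi elliptic functions of modulus $p$. Let $G_{n,m}$ be the group of transformations of $\mathbb R^2$ generated by $$(x,y)\mapsto (x+4K/r,\,y),\qquad (x,y)\mapsto(-x,\,y+\sqrt2\,mb\pi/3),$$ and let $K_{n,m}=\mathbb R^2/G_{n,m}$ be the Klein bottle with the Riemannian metric induced by the minimal Lagrangian immersion $\Phi_{n,m}:K_{n,m}\to\mathbb{CP}^2$, $$(x,y)\mapsto\left[\left(\sqrt{\tfrac{n}{2n+m}}\,\mathrm{dn}(rx)e^{\frac{i(n+m)y}{\sqrt2mb}},\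 \sqrt{\tfrac{n+m}{2n+m}}\,\mathrm{cn}(rx)e^{\frac{-iny}{\sqrt2mb}},\ \sqrt{\tfrac{n+m}{n+2m}}\,\mathrm{sn}(rx)e^{\frac{-iy}{\sqrt2b}}\right)\right],$$ where $\mathbb{CP}^2$ carries the Fubini--Study metric of constant holomorphic sectional curvature $4$. Then: 1. The first positive eigenvalue $\lambda_1$ of the Laplacian on functions of $K_{n,m}$ (the least $\lambda>0$ such that $\Delta f+\lambda f=0$ for some nonzero smooth $f:K_{n,m}\to\mathbb R$, where $\Delta$ is the Laplace--Beltrami operator) exists and satisfies $$\lambda_1<2-\frac1{2b^3}=2-\frac{m^2}{n(n+m)}.$$ 2. The area of $K_{n,m}$ is $$\frac{4\pi\sqrt n}{3\sqrt{n+2m}}\,\bigl((n+2m)E-mK\bigr).$$ -/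

import Mathlib

open scoped ContDiff

noncomputable section

namespace KleinCP2

/-! ### Elliptic integrals and Jacobi elliptic functions of modulus `p` -/

/-- Incomplete elliptic integral of the first kind. -/
def ellipticF (p φ : ℝ) : ℝ := ∫ θ in (0 : ℝ)..φ, 1 / √(1 - p ^ 2 * Real.sin θ ^ 2)

/-- Complete elliptic integral of the first kind. -/
def ellipticK (p : ℝ) : ℝ := ∫ θ in (0 : ℝ)..(Real.pi / 2), 1 / √(1 - p ^ 2 * Real.sin θ ^ 2)

/-- Complete elliptic integral of the second kind. -/
def ellipticE (p : ℝ) : ℝ := ∫ θ in (0 : ℝ)..(Real.pi / 2), √(1 - p ^ 2 * Real.sin θ ^ 2)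

/-- Jacobi amplitude: the inverse function of `φ ↦ ellipticF p φ`, which is a bijection of `ℝ`
for `0 ≤ p < 1` (see `ellipticF_bijective`). -/
def jacobiAm (p : ℝ) : ℝ → ℝ := Function.invFun (ellipticF p)

def jacobiSn (p x : ℝ) : ℝ := Real.sin (jacobiAm p x)

def jacobiCn (p x : ℝ) : ℝ := Real.cos (jacobiAm p x)

def jacobiDn (p x : ℝ) : ℝ := √(1 - p ^ 2 * jacobiSn p x ^ 2)

/-! ### Surfaces given by a metric on the plane and a group of transformations -/

/-- The coordinate vector fields `∂/∂x`, `∂/∂y` of the plane. -/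
def coordVec : Fin 2 → ℝ × ℝ := ![(1, 0), (0, 1)]

/-- Partial derivative of a function on the plane. -/
def pderiv {F : Type*} [NormedAddCommGroup F] [NormedSpace ℝ F]
    (i : Fin 2) (f : ℝ × ℝ → F) (q : ℝ × ℝ) : F :=
  fderiv ℝ f q (coordVec i)

/-- Horizontal part, for the Hopf projection from the unit sphere of `ℂ³` to the complex
projective plane, of a vector `v` at a point `z` of the sphere. -/
def hopfHorizontal (z v : EuclideanSpace ℂ (Fin 3)) : EuclideanSpace ℂ (Fin 3) :=
  v - (inner ℂ z v) • z

/-- The metric induced on the plane by `[ψ]`, where `ψ` takes values in the unit sphere of `ℂ³` and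
the complex projective plane carries the Fubini-Study metric of constant holomorphic
sectional curvature `4`, that is, the metric for which the Hopf projection from the unit sphere is a
Riemannian submersion. -/
def inducedMetric (ψ : ℝ × ℝ → EuclideanSpace ℂ (Fin 3)) (q : ℝ × ℝ) : Matrix (Fin 2) (Fin 2) ℝ :=
  Matrix.of fun i j =>
    (inner ℂ (hopfHorizontal (ψ q) (pderiv i ψ q)) (hopfHorizontal (ψ q) (pderiv j ψ q))).re

/-- Area density `√(det g)` of a metric on the plane. -/
def areaDensity (g : ℝ × ℝ → Matrix (Fin 2) (Fin 2) ℝ) (q : ℝ × ℝ) : ℝ := √((g q).det)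

/-- Riemannian area measure of a metric on the plane. -/
def areaMeasure (g : ℝ × ℝ → Matrix (Fin 2) (Fin 2) ℝ) : MeasureTheory.Measure (ℝ × ℝ) :=
  MeasureTheory.volume.withDensity fun q => ENNReal.ofReal (areaDensity g q)

/-- Laplace-Beltrami operator `(det g)^(-1/2) ∑ ∂_i ((det g)^(1/2) g^{ij} ∂_j f)` of a metric on
the plane (sign convention: `∂_x² + ∂_y²` for the flat metric). -/
def laplaceBeltrami (g : ℝ × ℝ → Matrix (Fin 2) (Fin 2) ℝ) (f : ℝ × ℝ → ℝ) (q : ℝ × ℝ) : ℝ :=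
  (areaDensity g q)⁻¹ *
    ∑ i, pderiv i (fun q' => areaDensity g q' * ∑ j, (g q')⁻¹ i j * pderiv j f q') q

/-- The quotient of the plane by a group of transformations. -/
def PlaneQuotient (G : Subgroup (Equiv.Perm (ℝ × ℝ))) : Type :=
  MulAction.orbitRel.Quotient G (ℝ × ℝ)

/-- The projection of the plane onto its quotient. -/
def PlaneQuotient.proj (G : Subgroup (Equiv.Perm (ℝ × ℝ))) (q : ℝ × ℝ) : PlaneQuotient G :=
  Quotient.mk (MulAction.orbitRel G (ℝ × ℝ)) q

/-- The positive eigenvalues of the Laplacian on smooth real functions on the quotient of the plane,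
with a metric `g`, by a group `G` acting by isometries of `g`, freely and properly
discontinuously: `lam > 0` with `Δ f + lam f = 0` for some smooth `f ≠ 0` on the quotient.
As the projection is a local isometry, smoothness and the Laplacian are read in the plane. -/
def positiveEigenvalues (G : Subgroup (Equiv.Perm (ℝ × ℝ)))
    (g : ℝ × ℝ → Matrix (Fin 2) (Fin 2) ℝ) : Set ℝ :=
  {lam | 0 < lam ∧ ∃ f : PlaneQuotient G → ℝ,
    f ≠ 0 ∧ ContDiff ℝ ∞ (f ∘ PlaneQuotient.proj G) ∧
      ∀ q, laplaceBeltrami g (f ∘ PlaneQuotient.proj G) q + lam * f (PlaneQuotient.proj G q) = 0}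

/-- Area of the quotient of the plane, with metric `g`, by a discrete group `G` of isometries:
the area of a fundamental domain. -/
def quotientArea (G : Subgroup (Equiv.Perm (ℝ × ℝ)))
    (g : ℝ × ℝ → Matrix (Fin 2) (Fin 2) ℝ) : ENNReal :=
  MeasureTheory.covolume G (ℝ × ℝ) (areaMeasure g)

/-! ### The minimal Lagrangian Klein bottles `K_{n,m}` -/

/-- The parameter `b ≥ 1` with `(1 + √(1 + 8 b³)) / (4 b³) = m / n` (see `paramB_spec`). -/
def paramB (n m : ℤ) : ℝ := ((n : ℝ) * (n + m) / (2 * m ^ 2)) ^ (1 / 3 : ℝ)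

/-- The parameter `r > 0` with `r² = n (n + 2 m) / (2 b² m²)`. -/
def paramR (n m : ℤ) : ℝ := √((n : ℝ) * (n + 2 * m) / (2 * paramB n m ^ 2 * m ^ 2))

/-- The modulus `p ≥ 0` with `p² = (n² - m²) / (n (n + 2 m))`. -/
def modulus (n m : ℤ) : ℝ := √(((n : ℝ) ^ 2 - m ^ 2) / (n * (n + 2 * m)))

/-- The translation `(x, y) ↦ (x + a, y)`. -/
def translationX (a : ℝ) : Equiv.Perm (ℝ × ℝ) where
  toFun q := (q.1 + a, q.2)
  invFun q := (q.1 - a, q.2)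
  left_inv q := by simp
  right_inv q := by simp

/-- The glide reflection `(x, y) ↦ (-x, y + c)`. -/
def glideReflection (c : ℝ) : Equiv.Perm (ℝ × ℝ) where
  toFun q := (-q.1, q.2 + c)
  invFun q := (-q.1, q.2 - c)
  left_inv q := by simp
  right_inv q := by simp

/-- The group generated by `(x, y) ↦ (x + 4K/r, y)` and `(x, y) ↦ (-x, y + √2 m b π / 3)`. -/
def kleinGroup (n m : ℤ) : Subgroup (Equiv.Perm (ℝ × ℝ)) :=
  Subgroup.closure
    {translationX (4 * ellipticK (modulus n m) / paramR n m),
      glideReflection (√2 * m * paramB n m * Real.pi / 3)}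

/-- The unit-sphere lift of the immersion: `(x, y)` is sent to
`(λ dn(rx) e^{i(n+m)y/(√2 m b)}, μ cn(rx) e^{-iny/(√2 m b)}, ν sn(rx) e^{-iy/(√2 b)})`, with
`λ² = n/(2n+m)`, `μ² = (n+m)/(2n+m)`, `ν² = (n+m)/(n+2m)`. -/
def immersionLift (n m : ℤ) (q : ℝ × ℝ) : EuclideanSpace ℂ (Fin 3) :=
  let b := paramB n m
  let p := modulus n m
  let t := paramR n m * q.1
  !₂[((√((n : ℝ) / (2 * n + m)) * jacobiDn p t : ℝ) : ℂ) *
        Complex.exp (Complex.I * (((n + m) * q.2 / (√2 * m * b) : ℝ) : ℂ)),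
    ((√(((n : ℝ) + m) / (2 * n + m)) * jacobiCn p t : ℝ) : ℂ) *
        Complex.exp (-Complex.I * ((n * q.2 / (√2 * m * b) : ℝ) : ℂ)),
    ((√(((n : ℝ) + m) / (n + 2 * m)) * jacobiSn p t : ℝ) : ℂ) *
        Complex.exp (-Complex.I * ((q.2 / (√2 * b) : ℝ) : ℂ))]

/-- The metric induced on the plane, hence on the Klein bottle, by the immersion. -/
def kleinMetric (n m : ℤ) : ℝ × ℝ → Matrix (Fin 2) (Fin 2) ℝ := inducedMetric (immersionLift n m)

/-- The positive Laplace eigenvalues of `K_{n,m}`. -/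
def kleinPositiveEigenvalues (n m : ℤ) : Set ℝ :=
  positiveEigenvalues (kleinGroup n m) (kleinMetric n m)

/-- The area of `K_{n,m}`. -/
def kleinArea (n m : ℤ) : ENNReal := quotientArea (kleinGroup n m) (kleinMetric n m)

/-! ### Well-definedness of the amplitude and of `b` -/

theorem ellipticF_bijective {p : ℝ} (hp0 : 0 ≤ p) (hp1 : p < 1) :
    Function.Bijective (ellipticF p) := by
  have hpos : ∀ θ : ℝ, 0 < 1 - p ^ 2 * Real.sin θ ^ 2 := fun θ => by
    nlinarith [Real.sin_sq_le_one θ, sq_nonneg (Real.sin θ), sq_nonneg p]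
  have hcont : Continuous fun θ : ℝ => 1 / √(1 - p ^ 2 * Real.sin θ ^ 2) :=
    continuous_const.div (by fun_prop) fun θ => (Real.sqrt_pos.2 (hpos θ)).ne'
  have hge : ∀ θ : ℝ, 1 ≤ 1 / √(1 - p ^ 2 * Real.sin θ ^ 2) := fun θ => by
    rw [le_div_iff₀ (Real.sqrt_pos.2 (hpos θ)), one_mul]
    exact Real.sqrt_le_one.2 (by nlinarith [mul_nonneg (sq_nonneg p) (sq_nonneg (Real.sin θ))])
  have hd : ∀ φ, HasDerivAt (ellipticF p) (1 / √(1 - p ^ 2 * Real.sin φ ^ 2)) φ := fun φ =>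
    intervalIntegral.integral_hasDerivAt_right (hcont.intervalIntegrable _ _)
      (hcont.stronglyMeasurableAtFilter _ _) hcont.continuousAt
  have hF : Continuous (ellipticF p) :=
    continuous_iff_continuousAt.2 fun φ => (hd φ).continuousAt
  have h0 : ellipticF p 0 = 0 := by simp [ellipticF]
  have hmono : Monotone fun φ => ellipticF p φ - φ :=
    monotone_of_hasDerivAt_nonneg (fun φ => (hd φ).sub (hasDerivAt_id φ))
      fun φ => sub_nonneg.2 (hge φ)
  refine ⟨StrictMono.injective fun x y hxy => ?_, hF.surjective ?_ ?_⟩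
  · have := hmono hxy.le
    simp only at this
    linarith
  · refine Filter.tendsto_atTop_mono' _ ?_ Filter.tendsto_id
    filter_upwards [Filter.eventually_ge_atTop 0] with x hx
    have := hmono hx
    simp only [h0] at this
    simp only [id]
    linarith
  · refine Filter.tendsto_atBot_mono' _ ?_ Filter.tendsto_id
    filter_upwards [Filter.eventually_le_atBot 0] with x hx
    have := hmono hx
    simp only [h0] at this
    simp only [id]
    linarith

theorem paramB_spec {n m : ℤ} (hm : 0 < m) (hmn : m < n) (x : ℝ) :
    (1 ≤ x ∧ (1 + √(1 + 8 * x ^ 3)) / (4 * x ^ 3) = m / n) ↔ x = paramB n m := by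
  have hm' : (0 : ℝ) < m := by exact_mod_cast hm
  have hmn' : (m : ℝ) < n := by exact_mod_cast hmn
  have hn' : (0 : ℝ) < n := hm'.trans hmn'
  have hc : 0 ≤ (n : ℝ) * (n + m) / (2 * m ^ 2) := by positivity
  have hb3 : paramB n m ^ 3 = (n : ℝ) * (n + m) / (2 * m ^ 2) := by
    unfold paramB
    rw [← Real.rpow_natCast, ← Real.rpow_mul hc]
    norm_num
  have hb0 : 0 ≤ paramB n m := Real.rpow_nonneg hc _
  constructor
  · rintro ⟨hx, he⟩
    have hx3 : 0 < x ^ 3 := by positivity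
    rw [div_eq_div_iff (by positivity) hn'.ne'] at he
    have hs := Real.sq_sqrt (show 0 ≤ 1 + 8 * x ^ 3 by positivity)
    set s := √(1 + 8 * x ^ 3)
    have h1 : s * n = m * (4 * x ^ 3) - n := by linarith
    have h2 : (1 + 8 * x ^ 3) * n ^ 2 = (m * (4 * x ^ 3) - n) ^ 2 := by
      rw [← h1, ← hs]; ring
    have h3 : x ^ 3 * (8 * (n * (n + m) - 2 * m ^ 2 * x ^ 3)) = 0 := by linarith
    have h4 : (n : ℝ) * (n + m) - 2 * m ^ 2 * x ^ 3 = 0 := by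
      rcases mul_eq_zero.1 h3 with h | h <;> linarith
    refine (pow_left_inj₀ (by linarith) hb0 (by norm_num : (3 : ℕ) ≠ 0)).1 ?_
    rw [hb3, eq_div_iff (by positivity)]
    linarith
  · rintro rfl
    have h1 : (1 : ℝ) ≤ paramB n m :=
      Real.one_le_rpow (by rw [le_div_iff₀ (by positivity)]; nlinarith) (by norm_num)
    refine ⟨h1, ?_⟩
    rw [hb3, show 1 + 8 * ((n : ℝ) * (n + m) / (2 * m ^ 2)) = ((2 * n + m) / m) ^ 2 by
      field_simp; ring, Real.sqrt_sq (by positivity)]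
    field_simp
    ring

end KleinCP2

end

namespace KleinCP2

open MeasureTheory

/-! ### Elliptic integrals and Jacobi functions -/

/-! The induced metric is conformally flat, ρ(x)(dx² + dy²) with ρ = r²((n+m)/(n+2m) − p² sn²(rx))
(`kleinMetric_eq`). In dimension two the eigenvalue equation therefore becomes F_xx + F_yy + λρF = 0
for functions F on the plane that are invariant under the two generators
(`mem_kleinPositiveEigenvalues`).

Upper bound: a function u(x) of x alone descends to the Klein bottle when it is even and
4K/r-periodic, and the equation reduces to u'' + λρu = 0. Write σ = 2 − m²/(n(n+m)). The function v
= cn(rx) solves v'' + kv = 0 with k < σρ, and it first vanishes at the quarter period A = K/r. By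
Sturm comparison (`pi_div_two_lt_prufer_angle`) the Prüfer angle at A exceeds π/2 for λ = σ, while
it is 0 for λ = 0. It is continuous in λ, so it equals π/2 for some λ strictly between. For that λ
the even solution vanishes at A, and the symmetries of ρ make it 4A-periodic
(`exists_even_periodic_eigenfunction`).

A least eigenvalue exists because only finitely many lie below any bound. On a torus covering the
Klein bottle, eigenfunctions of distinct eigenvalues are orthogonal. Among N² + 1 of them some
nonzero combination has mean zero on each of N² cells. The Poincaré inequality on the cells makes
its Rayleigh quotient large, while `IsTorusEigenfunction.rayleigh` bounds that quotient by the given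
bound (`finite_torus_eigenvalues`).

Area: a rectangle of sides 4K/r and √2 mbπ/3 is a fundamental domain
(`isFundamentalDomain_Ico_prod_Ico`). As ρ is r² dn²(rx) up to an additive constant, its integral
reduces to E and K (`integral_jacobiDn_sq`). -/

theorem one_sub_sq_mul_sin_sq_pos {p : ℝ} (hp0 : 0 ≤ p) (hp1 : p < 1) (θ : ℝ) :
    0 < 1 - p ^ 2 * Real.sin θ ^ 2 := by
  nlinarith [Real.sin_sq_le_one θ, sq_nonneg (Real.sin θ), sq_nonneg p]

theorem hasDerivAt_ellipticF {p : ℝ} (hp0 : 0 ≤ p) (hp1 : p < 1) (φ : ℝ) :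
    HasDerivAt (ellipticF p) (1 / √(1 - p ^ 2 * Real.sin φ ^ 2)) φ := by
  have hcont : Continuous fun θ : ℝ => 1 / √(1 - p ^ 2 * Real.sin θ ^ 2) :=
    continuous_const.div (by fun_prop) fun θ =>
      (Real.sqrt_pos.2 (one_sub_sq_mul_sin_sq_pos hp0 hp1 θ)).ne'
  exact intervalIntegral.integral_hasDerivAt_right (hcont.intervalIntegrable _ _)
    (hcont.stronglyMeasurableAtFilter _ _) hcont.continuousAt

theorem ellipticF_zero (p : ℝ) : ellipticF p 0 = 0 := by simp [ellipticF]

theorem ellipticF_pi_div_two (p : ℝ) : ellipticF p (Real.pi / 2) = ellipticK p := rfl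

theorem strictMono_ellipticF {p : ℝ} (hp0 : 0 ≤ p) (hp1 : p < 1) : StrictMono (ellipticF p) :=
  strictMono_of_hasDerivAt_pos (hasDerivAt_ellipticF hp0 hp1) fun φ =>
    div_pos one_pos (Real.sqrt_pos.2 (one_sub_sq_mul_sin_sq_pos hp0 hp1 φ))

theorem ellipticK_pos {p : ℝ} (hp0 : 0 ≤ p) (hp1 : p < 1) : 0 < ellipticK p := by
  have := strictMono_ellipticF hp0 hp1 (half_pos Real.pi_pos)
  rwa [ellipticF_zero, ellipticF_pi_div_two] at this

theorem ellipticF_neg {p : ℝ} (hp0 : 0 ≤ p) (hp1 : p < 1) (φ : ℝ) :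
    ellipticF p (-φ) = -ellipticF p φ := by
  have hd : ∀ x, HasDerivAt (fun x => ellipticF p (-x) + ellipticF p x) 0 x := fun x => by
    have h1 := ((hasDerivAt_ellipticF hp0 hp1 (-x)).comp x (hasDerivAt_neg x)).add
      (hasDerivAt_ellipticF hp0 hp1 x)
    convert! h1 using 1
    simp
  have h := is_const_of_deriv_eq_zero (fun x => (hd x).differentiableAt) (fun x => (hd x).deriv)
    φ 0
  simp only [neg_zero, ellipticF_zero, add_zero] at h
  linarith

theorem ellipticF_pi_sub {p : ℝ} (hp0 : 0 ≤ p) (hp1 : p < 1) (φ : ℝ) :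
    ellipticF p (Real.pi - φ) = 2 * ellipticK p - ellipticF p φ := by
  have hd : ∀ x, HasDerivAt (fun x => ellipticF p (Real.pi - x) + ellipticF p x) 0 x := fun x => by
    have h1 := ((hasDerivAt_ellipticF hp0 hp1 (Real.pi - x)).comp x
      ((hasDerivAt_id x).const_sub Real.pi)).add (hasDerivAt_ellipticF hp0 hp1 x)
    convert! h1 using 1
    simp
  have h := is_const_of_deriv_eq_zero (fun x => (hd x).differentiableAt) (fun x => (hd x).deriv)
    φ (Real.pi / 2)
  simp only [sub_half, ellipticF_pi_div_two] at h
  linarith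

theorem ellipticF_jacobiAm {p : ℝ} (hp0 : 0 ≤ p) (hp1 : p < 1) (x : ℝ) :
    ellipticF p (jacobiAm p x) = x :=
  Function.rightInverse_invFun (ellipticF_bijective hp0 hp1).2 x

theorem jacobiAm_ellipticF {p : ℝ} (hp0 : 0 ≤ p) (hp1 : p < 1) (φ : ℝ) :
    jacobiAm p (ellipticF p φ) = φ :=
  Function.leftInverse_invFun (ellipticF_bijective hp0 hp1).1 φ

theorem jacobiAm_zero {p : ℝ} (hp0 : 0 ≤ p) (hp1 : p < 1) : jacobiAm p 0 = 0 := by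
  simpa [ellipticF_zero] using jacobiAm_ellipticF hp0 hp1 0

theorem jacobiAm_ellipticK {p : ℝ} (hp0 : 0 ≤ p) (hp1 : p < 1) :
    jacobiAm p (ellipticK p) = Real.pi / 2 :=
  jacobiAm_ellipticF hp0 hp1 (Real.pi / 2)

theorem jacobiAm_neg {p : ℝ} (hp0 : 0 ≤ p) (hp1 : p < 1) (x : ℝ) :
    jacobiAm p (-x) = -jacobiAm p x := by
  apply (ellipticF_bijective hp0 hp1).1
  rw [ellipticF_neg hp0 hp1, ellipticF_jacobiAm hp0 hp1, ellipticF_jacobiAm hp0 hp1]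

theorem jacobiAm_two_mul_sub {p : ℝ} (hp0 : 0 ≤ p) (hp1 : p < 1) (x : ℝ) :
    jacobiAm p (2 * ellipticK p - x) = Real.pi - jacobiAm p x := by
  apply (ellipticF_bijective hp0 hp1).1
  rw [ellipticF_pi_sub hp0 hp1, ellipticF_jacobiAm hp0 hp1, ellipticF_jacobiAm hp0 hp1]

theorem strictMono_jacobiAm {p : ℝ} (hp0 : 0 ≤ p) (hp1 : p < 1) : StrictMono (jacobiAm p) := by
  intro x y hxy
  rw [← (strictMono_ellipticF hp0 hp1).lt_iff_lt, ellipticF_jacobiAm hp0 hp1,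
    ellipticF_jacobiAm hp0 hp1]
  exact hxy

theorem continuous_jacobiAm {p : ℝ} (hp0 : 0 ≤ p) (hp1 : p < 1) : Continuous (jacobiAm p) :=
  (strictMono_jacobiAm hp0 hp1).monotone.continuous_of_surjective fun φ =>
    ⟨_, jacobiAm_ellipticF hp0 hp1 φ⟩

theorem hasDerivAt_jacobiAm {p : ℝ} (hp0 : 0 ≤ p) (hp1 : p < 1) (x : ℝ) :
    HasDerivAt (jacobiAm p) (jacobiDn p x) x := by
  have hpos := Real.sqrt_pos.2 (one_sub_sq_mul_sin_sq_pos hp0 hp1 (jacobiAm p x))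
  have h := (hasDerivAt_ellipticF hp0 hp1 (jacobiAm p x)).of_local_left_inverse
    (continuous_jacobiAm hp0 hp1).continuousAt (by positivity)
    (Filter.Eventually.of_forall (ellipticF_jacobiAm hp0 hp1))
  simpa [jacobiDn, jacobiSn] using h

/-- The amplitude solves am' = √(1 − p² sin² am), whose right side is smooth in am, so each order of
regularity yields the next. -/
theorem contDiff_jacobiAm {p : ℝ} (hp0 : 0 ≤ p) (hp1 : p < 1) : ContDiff ℝ ∞ (jacobiAm p) := by
  rw [contDiff_infty]
  intro k
  induction k with
  | zero => exact contDiff_zero.2 (continuous_jacobiAm hp0 hp1)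
  | succ k ih =>
    rw [show ((k + 1 : ℕ) : WithTop ℕ∞) = (k : WithTop ℕ∞) + 1 by push_cast; rfl,
      contDiff_succ_iff_deriv]
    refine ⟨fun x => (hasDerivAt_jacobiAm hp0 hp1 x).differentiableAt, by simp, ?_⟩
    rw [show deriv (jacobiAm p) = fun x => √(1 - p ^ 2 * Real.sin (jacobiAm p x) ^ 2) from
      funext fun x => (hasDerivAt_jacobiAm hp0 hp1 x).deriv]
    refine ContDiff.sqrt ?_ fun x => (one_sub_sq_mul_sin_sq_pos hp0 hp1 _).ne'
    exact contDiff_const.sub (contDiff_const.mul ((Real.contDiff_sin.comp ih).pow 2))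

theorem contDiff_jacobiSn {p : ℝ} (hp0 : 0 ≤ p) (hp1 : p < 1) : ContDiff ℝ ∞ (jacobiSn p) :=
  Real.contDiff_sin.comp (contDiff_jacobiAm hp0 hp1)

theorem jacobiDn_pos {p : ℝ} (hp0 : 0 ≤ p) (hp1 : p < 1) (x : ℝ) : 0 < jacobiDn p x :=
  Real.sqrt_pos.2 (one_sub_sq_mul_sin_sq_pos hp0 hp1 _)

theorem jacobiDn_sq {p : ℝ} (hp0 : 0 ≤ p) (hp1 : p < 1) (x : ℝ) :
    jacobiDn p x ^ 2 = 1 - p ^ 2 * jacobiSn p x ^ 2 :=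
  Real.sq_sqrt (one_sub_sq_mul_sin_sq_pos hp0 hp1 _).le

theorem jacobiCn_sq (p x : ℝ) : jacobiCn p x ^ 2 = 1 - jacobiSn p x ^ 2 :=
  Real.cos_sq' _

theorem hasDerivAt_jacobiSn {p : ℝ} (hp0 : 0 ≤ p) (hp1 : p < 1) (x : ℝ) :
    HasDerivAt (jacobiSn p) (jacobiCn p x * jacobiDn p x) x :=
  (Real.hasDerivAt_sin _).comp x (hasDerivAt_jacobiAm hp0 hp1 x)

theorem hasDerivAt_jacobiCn {p : ℝ} (hp0 : 0 ≤ p) (hp1 : p < 1) (x : ℝ) :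
    HasDerivAt (jacobiCn p) (-jacobiSn p x * jacobiDn p x) x :=
  (Real.hasDerivAt_cos _).comp x (hasDerivAt_jacobiAm hp0 hp1 x)

theorem hasDerivAt_jacobiDn {p : ℝ} (hp0 : 0 ≤ p) (hp1 : p < 1) (x : ℝ) :
    HasDerivAt (jacobiDn p) (-p ^ 2 * jacobiSn p x * jacobiCn p x) x := by
  have h0 := jacobiDn_pos hp0 hp1 x
  have h := ((((hasDerivAt_jacobiSn hp0 hp1 x).fun_pow 2).const_mul (p ^ 2)).const_sub 1).sqrt
    (one_sub_sq_mul_sin_sq_pos hp0 hp1 (jacobiAm p x)).ne'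
  refine h.congr_deriv ?_
  change _ / (2 * jacobiDn p x) = _
  field_simp
  norm_num
  ring

theorem jacobiSn_neg {p : ℝ} (hp0 : 0 ≤ p) (hp1 : p < 1) (x : ℝ) :
    jacobiSn p (-x) = -jacobiSn p x := by
  simp [jacobiSn, jacobiAm_neg hp0 hp1]

theorem jacobiSn_two_mul_sub {p : ℝ} (hp0 : 0 ≤ p) (hp1 : p < 1) (x : ℝ) :
    jacobiSn p (2 * ellipticK p - x) = jacobiSn p x := by
  simp [jacobiSn, jacobiAm_two_mul_sub hp0 hp1]

theorem jacobiCn_pos_of_mem_Ico {p x : ℝ} (hp0 : 0 ≤ p) (hp1 : p < 1)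
    (hx : x ∈ Set.Ico 0 (ellipticK p)) : 0 < jacobiCn p x := by
  have h1 := (strictMono_jacobiAm hp0 hp1).monotone hx.1
  have h2 := strictMono_jacobiAm hp0 hp1 hx.2
  rw [jacobiAm_zero hp0 hp1] at h1
  rw [jacobiAm_ellipticK hp0 hp1] at h2
  exact Real.cos_pos_of_mem_Ioo ⟨by linarith [Real.pi_pos], h2⟩

/-- The substitution `θ = am x` in the integral of the second kind. -/
theorem integral_jacobiDn_sq {p : ℝ} (hp0 : 0 ≤ p) (hp1 : p < 1) :
    ∫ x in (0 : ℝ)..ellipticK p, jacobiDn p x ^ 2 = ellipticE p := by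
  have h := intervalIntegral.integral_comp_mul_deriv (a := 0) (b := ellipticK p)
    (f := jacobiAm p) (f' := jacobiDn p) (g := fun θ => √(1 - p ^ 2 * Real.sin θ ^ 2))
    (fun x _ => hasDerivAt_jacobiAm hp0 hp1 x)
    (fun x _ => (hasDerivAt_jacobiDn hp0 hp1 x).continuousAt.continuousWithinAt) (by fun_prop)
  rw [jacobiAm_zero hp0 hp1, jacobiAm_ellipticK hp0 hp1] at h
  rw [ellipticE, ← h]
  exact intervalIntegral.integral_congr fun x _ => sq _

/-! ### The induced metric is conformal -/

theorem hasFDerivAt_real_mul_cexp {A : ℝ → ℝ} {A' : ℝ} (s : ℝ) {q : ℝ × ℝ}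
    (hA : HasDerivAt A A' q.1) :
    HasFDerivAt (fun q : ℝ × ℝ => (A q.1 : ℂ) * Complex.exp (Complex.I * ((s * q.2 : ℝ) : ℂ)))
      ((ContinuousLinearMap.fst ℝ ℝ ℝ).smulRight
          ((A' : ℂ) * Complex.exp (Complex.I * ((s * q.2 : ℝ) : ℂ))) +
        (ContinuousLinearMap.snd ℝ ℝ ℝ).smulRight
          (Complex.I * (s * A q.1 : ℝ) * Complex.exp (Complex.I * ((s * q.2 : ℝ) : ℂ)))) q := by
  have h1 : HasFDerivAt (fun q : ℝ × ℝ => (A q.1 : ℂ)) _ q :=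
    (hA.ofReal_comp).hasFDerivAt.comp q (hasFDerivAt_fst (𝕜 := ℝ) (p := q))
  have h2 : HasDerivAt (fun y : ℝ => Complex.exp (Complex.I * ((s * y : ℝ) : ℂ)))
      (Complex.exp (Complex.I * ((s * q.2 : ℝ) : ℂ)) * (Complex.I * ((s * 1 : ℝ) : ℂ))) q.2 :=
    ((((hasDerivAt_id q.2).const_mul s).ofReal_comp).const_mul Complex.I).cexp
  have h3 := h2.hasFDerivAt.comp q (hasFDerivAt_snd (𝕜 := ℝ) (p := q))
  refine (h1.mul h3).congr_fderiv ?_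
  ext <;> simp <;> ring

/-- `h0` and `h1` make the x- and y-derivatives Hermitian-orthogonal to `ψ`, so both are already
horizontal. Relative to the common phases the x-derivative is real and the y-derivative purely
imaginary; hence the off-diagonal real part vanishes. -/
theorem inducedMetric_of_phases {A A' : Fin 3 → ℝ → ℝ} (s : Fin 3 → ℝ)
    {ψ : ℝ × ℝ → EuclideanSpace ℂ (Fin 3)}
    (hψ : ∀ i q, ψ q i = (A i q.1 : ℂ) * Complex.exp (Complex.I * ((s i * q.2 : ℝ) : ℂ)))
    (hA : ∀ i x, HasDerivAt (A i) (A' i x) x)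
    (h0 : ∀ x, ∑ i, A i x * A' i x = 0) (h1 : ∀ x, ∑ i, s i * A i x ^ 2 = 0) (q : ℝ × ℝ) :
    inducedMetric ψ q = !![∑ i, A' i q.1 ^ 2, 0; 0, ∑ i, s i ^ 2 * A i q.1 ^ 2] := by
  have hd : ∀ i, HasFDerivAt (fun q => ψ q i) _ q := fun i => by
    simpa only [hψ] using hasFDerivAt_real_mul_cexp (s i) (hA i q.1)
  have hdiff : DifferentiableAt ℝ ψ q :=
    (differentiableAt_piLp 2).2 fun i => (hd i).differentiableAt
  have hp : ∀ j i, pderiv j ψ q i = fderiv ℝ (fun q => ψ q i) q (coordVec j) := fun j i => by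
    have := ((PiLp.proj (𝕜 := ℝ) 2 (fun _ : Fin 3 => ℂ) i).hasFDerivAt.comp q
      hdiff.hasFDerivAt).fderiv
    change _ = fderiv ℝ ((PiLp.proj (𝕜 := ℝ) 2 (fun _ : Fin 3 => ℂ) i) ∘ ψ) q _
    rw [this]
    rfl
  have hp0 : ∀ i, pderiv 0 ψ q i =
      (A' i q.1 : ℂ) * Complex.exp (Complex.I * ((s i * q.2 : ℝ) : ℂ)) := fun i => by
    rw [hp, (hd i).fderiv]; simp [coordVec]
  have hp1 : ∀ i, pderiv 1 ψ q i =
      Complex.I * (s i * A i q.1 : ℝ) * Complex.exp (Complex.I * ((s i * q.2 : ℝ) : ℂ)) :=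
    fun i => by rw [hp, (hd i).fderiv]; simp [coordVec]
  have he : ∀ i, Complex.exp (Complex.I * ((s i * q.2 : ℝ) : ℂ)) *
      (starRingEnd ℂ) (Complex.exp (Complex.I * ((s i * q.2 : ℝ) : ℂ))) = 1 := fun i => by
    rw [Complex.mul_conj, mul_comm Complex.I, Complex.normSq_eq_norm_sq,
      Complex.norm_exp_ofReal_mul_I]
    simp
  have key : ∀ (i : Fin 3) (u v : ℂ) , (u * Complex.exp (Complex.I * ((s i * q.2 : ℝ) : ℂ))) *
      (starRingEnd ℂ) (v * Complex.exp (Complex.I * ((s i * q.2 : ℝ) : ℂ))) =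
        u * (starRingEnd ℂ) v := fun i u v => by
    rw [map_mul]
    linear_combination (u * (starRingEnd ℂ) v) * he i
  have i0 : inner ℂ (ψ q) (pderiv 0 ψ q) = 0 := by
    rw [PiLp.inner_apply]
    simp only [RCLike.inner_apply, hp0, hψ, key, Complex.conj_ofReal]
    rw [← Complex.ofReal_zero, ← h0 q.1]
    push_cast
    exact Finset.sum_congr rfl fun i _ => mul_comm _ _
  have i1 : inner ℂ (ψ q) (pderiv 1 ψ q) = 0 := by
    rw [PiLp.inner_apply]
    simp only [RCLike.inner_apply, hp1, hψ, key, Complex.conj_ofReal]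
    rw [show (0 : ℂ) = Complex.I * ((0 : ℝ) : ℂ) by simp, ← h1 q.1]
    push_cast
    rw [Finset.mul_sum]
    exact Finset.sum_congr rfl fun i _ => by ring
  have hh0 : hopfHorizontal (ψ q) (pderiv 0 ψ q) = pderiv 0 ψ q := by simp [hopfHorizontal, i0]
  have hh1 : hopfHorizontal (ψ q) (pderiv 1 ψ q) = pderiv 1 ψ q := by simp [hopfHorizontal, i1]
  ext i j
  fin_cases i <;> fin_cases j <;>
    simp only [inducedMetric, Matrix.of_apply, Fin.zero_eta, Fin.mk_one, hh0, hh1,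
      PiLp.inner_apply, RCLike.inner_apply, hp0, hp1, key, Complex.re_sum] <;>
    simp only [map_mul, Complex.conj_ofReal, Complex.conj_I] <;>
    simp [Fin.sum_univ_three] <;> ring

/-! ### The parameters -/

theorem paramB_cube {n m : ℤ} (hm : 0 < m) (hmn : m < n) :
    paramB n m ^ 3 = (n : ℝ) * (n + m) / (2 * m ^ 2) := by
  have hm' : (0 : ℝ) < m := by exact_mod_cast hm
  have hmn' : (m : ℝ) < n := by exact_mod_cast hmn
  have hn' : (0 : ℝ) < n := hm'.trans hmn'
  unfold paramB
  rw [← Real.rpow_natCast, ← Real.rpow_mul (by positivity)]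
  norm_num

theorem paramB_pos {n m : ℤ} (hm : 0 < m) (hmn : m < n) : 0 < paramB n m := by
  have hm' : (0 : ℝ) < m := by exact_mod_cast hm
  have hmn' : (m : ℝ) < n := by exact_mod_cast hmn
  have hn' : (0 : ℝ) < n := hm'.trans hmn'
  exact Real.rpow_pos_of_pos (by positivity) _

theorem paramR_sq {n m : ℤ} (hm : 0 < m) (hmn : m < n) :
    paramR n m ^ 2 = (n : ℝ) * (n + 2 * m) / (2 * paramB n m ^ 2 * m ^ 2) := by
  have hm' : (0 : ℝ) < m := by exact_mod_cast hm
  have hmn' : (m : ℝ) < n := by exact_mod_cast hmn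
  have hn' : (0 : ℝ) < n := hm'.trans hmn'
  exact Real.sq_sqrt (by positivity)

theorem paramR_pos {n m : ℤ} (hm : 0 < m) (hmn : m < n) : 0 < paramR n m := by
  have hm' : (0 : ℝ) < m := by exact_mod_cast hm
  have hmn' : (m : ℝ) < n := by exact_mod_cast hmn
  have hn' : (0 : ℝ) < n := hm'.trans hmn'
  have hb := paramB_pos hm hmn
  exact Real.sqrt_pos.2 (by positivity)

theorem modulus_sq {n m : ℤ} (hm : 0 < m) (hmn : m < n) :
    modulus n m ^ 2 = ((n : ℝ) ^ 2 - m ^ 2) / (n * (n + 2 * m)) := by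
  have hm' : (0 : ℝ) < m := by exact_mod_cast hm
  have hmn' : (m : ℝ) < n := by exact_mod_cast hmn
  have hn' : (0 : ℝ) < n := hm'.trans hmn'
  exact Real.sq_sqrt (div_nonneg (by nlinarith) (by positivity))

theorem modulus_nonneg (n m : ℤ) : 0 ≤ modulus n m := Real.sqrt_nonneg _

theorem modulus_pos {n m : ℤ} (hm : 0 < m) (hmn : m < n) : 0 < modulus n m := by
  have hm' : (0 : ℝ) < m := by exact_mod_cast hm
  have hmn' : (m : ℝ) < n := by exact_mod_cast hmn
  have hn' : (0 : ℝ) < n := hm'.trans hmn'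
  exact Real.sqrt_pos.2 (div_pos (by nlinarith) (by positivity))

theorem modulus_lt_one {n m : ℤ} (hm : 0 < m) (hmn : m < n) : modulus n m < 1 := by
  have hm' : (0 : ℝ) < m := by exact_mod_cast hm
  have hmn' : (m : ℝ) < n := by exact_mod_cast hmn
  have hn' : (0 : ℝ) < n := hm'.trans hmn'
  rw [← sq_lt_one_iff₀ (modulus_nonneg n m), modulus_sq hm hmn, div_lt_one (by positivity)]
  nlinarith

/-- The conformal factor of the metric of `K_{n,m}` with respect to the flat metric. -/
noncomputable def conformalFactor (n m : ℤ) (x : ℝ) : ℝ :=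
  paramR n m ^ 2 * (((n : ℝ) + m) / (n + 2 * m) -
    modulus n m ^ 2 * jacobiSn (modulus n m) (paramR n m * x) ^ 2)

theorem kleinMetric_eq {n m : ℤ} (hm : 0 < m) (hmn : m < n) (q : ℝ × ℝ) :
    kleinMetric n m q = !![conformalFactor n m q.1, 0; 0, conformalFactor n m q.1] := by
  have hm' : (0 : ℝ) < m := by exact_mod_cast hm
  have hmn' : (m : ℝ) < n := by exact_mod_cast hmn
  have hn' : (0 : ℝ) < n := hm'.trans hmn'
  have hb := paramB_pos hm hmn
  have hb3 := paramB_cube hm hmn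
  have hr := paramR_sq hm hmn
  have hp0 := modulus_nonneg n m
  have hp1 := modulus_lt_one hm hmn
  have hp := modulus_sq hm hmn
  set b := paramB n m with hbdef
  set r := paramR n m with hrdef
  set p := modulus n m with hpdef
  have h2 : √2 ^ 2 = (2 : ℝ) := Real.sq_sqrt (by norm_num)
  have h2p : 0 < √(2 : ℝ) := Real.sqrt_pos.2 (by norm_num)
  have hl : √((n : ℝ) / (2 * n + m)) ^ 2 = (n : ℝ) / (2 * n + m) := Real.sq_sqrt (by positivity)
  have hmu : √(((n : ℝ) + m) / (2 * n + m)) ^ 2 = ((n : ℝ) + m) / (2 * n + m) :=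
    Real.sq_sqrt (by positivity)
  have hnu : √(((n : ℝ) + m) / (n + 2 * m)) ^ 2 = ((n : ℝ) + m) / (n + 2 * m) :=
    Real.sq_sqrt (by positivity)
  set l := √((n : ℝ) / (2 * n + m)) with hldef
  set mu := √(((n : ℝ) + m) / (2 * n + m)) with hmudef
  set nu := √(((n : ℝ) + m) / (n + 2 * m)) with hnudef
  -- `E0` and `E1` are the relations that place the lift on the unit sphere; `E1` alone already
  -- gives the vanishing of ∑ A A'.
  have E0 : l ^ 2 + mu ^ 2 = 1 := by rw [hl, hmu]; field_simp; ring
  have E1 : nu ^ 2 = l ^ 2 * p ^ 2 + mu ^ 2 := by rw [hl, hmu, hnu, hp]; field_simp; ring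
  set d : ℝ := √2 * m * b with hd
  have hd2 : d ^ 2 = 2 * m ^ 2 * b ^ 2 := by rw [hd, mul_pow, mul_pow, h2]
  have hdp : 0 < d := by positivity
  have hin : ∀ x, HasDerivAt (fun x => r * x) r x := fun x => by
    simpa using (hasDerivAt_id x).const_mul r
  have hs : ∀ x, HasDerivAt (fun x => nu * jacobiSn p (r * x))
      (nu * (jacobiCn p (r * x) * jacobiDn p (r * x) * r)) x := fun x =>
    ((hasDerivAt_jacobiSn hp0 hp1 (r * x)).comp x (hin x)).const_mul nu
  have hc : ∀ x, HasDerivAt (fun x => mu * jacobiCn p (r * x))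
      (mu * (-jacobiSn p (r * x) * jacobiDn p (r * x) * r)) x := fun x =>
    ((hasDerivAt_jacobiCn hp0 hp1 (r * x)).comp x (hin x)).const_mul mu
  have hdn : ∀ x, HasDerivAt (fun x => l * jacobiDn p (r * x))
      (l * (-p ^ 2 * jacobiSn p (r * x) * jacobiCn p (r * x) * r)) x := fun x =>
    ((hasDerivAt_jacobiDn hp0 hp1 (r * x)).comp x (hin x)).const_mul l
  have key := inducedMetric_of_phases
    (A := ![fun x => l * jacobiDn p (r * x), fun x => mu * jacobiCn p (r * x),
      fun x => nu * jacobiSn p (r * x)])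
    (A' := ![fun x => l * (-p ^ 2 * jacobiSn p (r * x) * jacobiCn p (r * x) * r),
      fun x => mu * (-jacobiSn p (r * x) * jacobiDn p (r * x) * r),
      fun x => nu * (jacobiCn p (r * x) * jacobiDn p (r * x) * r)])
    ![(n + m) / d, -(n / d), -(m / d)] (ψ := immersionLift n m) ?_ ?_ ?_ ?_ q
  · rw [kleinMetric, key]
    have hC := jacobiCn_sq p (r * q.1)
    have hD := jacobiDn_sq hp0 hp1 (r * q.1)
    simp only [Fin.sum_univ_three, Matrix.cons_val_zero, Matrix.cons_val_one, Matrix.cons_val,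
      conformalFactor, ← hrdef, ← hpdef]
    have g0 : (l * (-p ^ 2 * jacobiSn p (r * q.1) * jacobiCn p (r * q.1) * r)) ^ 2 +
        (mu * (-jacobiSn p (r * q.1) * jacobiDn p (r * q.1) * r)) ^ 2 +
        (nu * (jacobiCn p (r * q.1) * jacobiDn p (r * q.1) * r)) ^ 2 =
        r ^ 2 * (((n : ℝ) + m) / (n + 2 * m) - p ^ 2 * jacobiSn p (r * q.1) ^ 2) := by
      rw [← hnu]
      set S := jacobiSn p (r * q.1)
      linear_combination (r ^ 2 * (l ^ 2 * p ^ 4 * S ^ 2 + nu ^ 2 * jacobiDn p (r * q.1) ^ 2)) * hC +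
        (r ^ 2 * (mu ^ 2 * S ^ 2 + nu ^ 2 * (1 - S ^ 2))) * hD +
        (r ^ 2 * ((1 - S ^ 2) * (1 - p ^ 2 * S ^ 2) - 1)) * E1 - r ^ 2 * p ^ 2 * S ^ 2 * E0
    have g1 : ((n + m) / d) ^ 2 * (l * jacobiDn p (r * q.1)) ^ 2 +
        (-(n / d)) ^ 2 * (mu * jacobiCn p (r * q.1)) ^ 2 +
        (-(m / d)) ^ 2 * (nu * jacobiSn p (r * q.1)) ^ 2 =
        r ^ 2 * (((n : ℝ) + m) / (n + 2 * m) - p ^ 2 * jacobiSn p (r * q.1) ^ 2) := by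
      simp only [mul_pow, div_pow, neg_sq, hl, hmu, hnu, hd2, hC, hD, hp, hr]
      field_simp
      ring
    rw [g0, g1]
  · intro i q
    have e1 : (n + m) * q.2 / (√2 * m * b) = (n + m) / d * q.2 := by rw [hd]; ring
    have e2 : n * q.2 / (√2 * m * b) = n / d * q.2 := by rw [hd]; ring
    have e3 : q.2 / (√2 * b) = m / d * q.2 := by rw [hd]; field_simp
    fin_cases i
    · simp [immersionLift, ← hbdef, ← hrdef, ← hpdef, ← hldef, ← hd]
      left
      ring_nf
    · simp [immersionLift, ← hbdef, ← hrdef, ← hpdef, ← hmudef, e2]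
    · simp [immersionLift, ← hbdef, ← hrdef, ← hpdef, ← hnudef, e3]
  · intro i x
    fin_cases i
    exacts [hdn x, hc x, hs x]
  · intro x
    simp only [Fin.sum_univ_three, Matrix.cons_val_zero, Matrix.cons_val_one, Matrix.cons_val]
    linear_combination (r * jacobiSn p (r * x) * jacobiCn p (r * x) * jacobiDn p (r * x)) * E1
  · intro x
    have hC := jacobiCn_sq p (r * x)
    have hD := jacobiDn_sq hp0 hp1 (r * x)
    simp only [Fin.sum_univ_three, Matrix.cons_val_zero, Matrix.cons_val_one, Matrix.cons_val]
    simp only [mul_pow, hl, hmu, hnu, hC, hD, hp]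
    field_simp
    ring

/-! ### The conformal factor -/

/-- The quarter period `K / r` of the conformal factor. -/
noncomputable def quarterPeriod (n m : ℤ) : ℝ := ellipticK (modulus n m) / paramR n m

theorem quarterPeriod_pos {n m : ℤ} (hm : 0 < m) (hmn : m < n) : 0 < quarterPeriod n m :=
  div_pos (ellipticK_pos (modulus_nonneg n m) (modulus_lt_one hm hmn)) (paramR_pos hm hmn)

theorem paramR_mul_quarterPeriod {n m : ℤ} (hm : 0 < m) (hmn : m < n) :
    paramR n m * quarterPeriod n m = ellipticK (modulus n m) :=
  mul_div_cancel₀ _ (paramR_pos hm hmn).ne'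

theorem conformalFactor_pos {n m : ℤ} (hm : 0 < m) (hmn : m < n) (x : ℝ) :
    0 < conformalFactor n m x := by
  have hm' : (0 : ℝ) < m := by exact_mod_cast hm
  have hmn' : (m : ℝ) < n := by exact_mod_cast hmn
  have hn' : (0 : ℝ) < n := hm'.trans hmn'
  refine mul_pos (pow_pos (paramR_pos hm hmn) 2) (sub_pos.2 ?_)
  have h1 : jacobiSn (modulus n m) (paramR n m * x) ^ 2 ≤ 1 := Real.sin_sq_le_one _
  -- Once sn² ≤ 1 is used, the claim is p² < (n+m)/(n+2m), which amounts to n − m < n.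
  refine (mul_le_of_le_one_right (sq_nonneg _) h1).trans_lt ?_
  rw [modulus_sq hm hmn, div_lt_div_iff₀ (by positivity) (by positivity)]
  nlinarith [mul_pos hn' hm', mul_pos (mul_pos hn' hm') hn', mul_pos (mul_pos hn' hm') hm',
    mul_pos (mul_pos hm' hm') hm']

theorem conformalFactor_le {n m : ℤ} (x : ℝ) :
    conformalFactor n m x ≤ paramR n m ^ 2 * (((n : ℝ) + m) / (n + 2 * m)) :=
  mul_le_mul_of_nonneg_left (sub_le_self _ (by positivity)) (sq_nonneg _)

theorem contDiff_conformalFactor {n m : ℤ} (hm : 0 < m) (hmn : m < n) :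
    ContDiff ℝ ∞ (conformalFactor n m) := by
  have := contDiff_jacobiSn (modulus_nonneg n m) (modulus_lt_one hm hmn)
  unfold conformalFactor
  fun_prop

theorem conformalFactor_neg {n m : ℤ} (hm : 0 < m) (hmn : m < n) (x : ℝ) :
    conformalFactor n m (-x) = conformalFactor n m x := by
  simp [conformalFactor, jacobiSn_neg (modulus_nonneg n m) (modulus_lt_one hm hmn)]

theorem conformalFactor_two_mul_sub {n m : ℤ} (hm : 0 < m) (hmn : m < n) (x : ℝ) :
    conformalFactor n m (2 * quarterPeriod n m - x) = conformalFactor n m x := by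
  rw [conformalFactor, show paramR n m * (2 * quarterPeriod n m - x) =
    2 * (paramR n m * quarterPeriod n m) - paramR n m * x by ring,
    paramR_mul_quarterPeriod hm hmn,
    jacobiSn_two_mul_sub (modulus_nonneg n m) (modulus_lt_one hm hmn), conformalFactor]

theorem conformalFactor_periodic {n m : ℤ} (hm : 0 < m) (hmn : m < n) :
    Function.Periodic (conformalFactor n m) (2 * quarterPeriod n m) := fun x => by
  rw [← conformalFactor_neg hm hmn x, ← conformalFactor_two_mul_sub hm hmn (-x)]
  ring_nf

/-! ### The Laplacian and the eigenvalue problem on the plane -/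

theorem contDiff_pderiv {f : ℝ × ℝ → ℝ} (hf : ContDiff ℝ ∞ f) (i : Fin 2) :
    ContDiff ℝ ∞ (pderiv i f) :=
  (hf.fderiv_right (by simp)).clm_apply contDiff_const

/-- In dimension two √(det g) g⁻¹ is the identity matrix for such a metric, so the weights cancel
inside the divergence and only the outer factor remains. -/
theorem laplaceBeltrami_conformal {ρ : ℝ × ℝ → ℝ} (hρ : ∀ q, 0 < ρ q)
    {g : ℝ × ℝ → Matrix (Fin 2) (Fin 2) ℝ} (hg : ∀ q, g q = !![ρ q, 0; 0, ρ q])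
    (f : ℝ × ℝ → ℝ) (q : ℝ × ℝ) :
    laplaceBeltrami g f q =
      (ρ q)⁻¹ * (pderiv 0 (pderiv 0 f) q + pderiv 1 (pderiv 1 f) q) := by
  have hA : ∀ q, areaDensity g q = ρ q := fun q => by
    rw [areaDensity, hg, Matrix.det_fin_two_of, mul_zero, sub_zero,
      Real.sqrt_mul_self (hρ q).le]
  have hI : ∀ q, (g q)⁻¹ = !![(ρ q)⁻¹, 0; 0, (ρ q)⁻¹] := fun q => by
    have := (hρ q).ne'
    refine Matrix.inv_eq_right_inv ?_
    rw [hg]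
    ext i j
    fin_cases i <;> fin_cases j <;> simp [Matrix.mul_apply, this]
  have h0 : (fun q' => areaDensity g q' * ∑ j, (g q')⁻¹ 0 j * pderiv j f q') = pderiv 0 f :=
    funext fun q' => by
      have := (hρ q').ne'
      simp [hA, hI, this]
  have h1 : (fun q' => areaDensity g q' * ∑ j, (g q')⁻¹ 1 j * pderiv j f q') = pderiv 1 f :=
    funext fun q' => by
      have := (hρ q').ne'
      simp [hA, hI, this]
  rw [laplaceBeltrami, hA, Fin.sum_univ_two, h0, h1]

theorem apply_smul_eq_of_mem_closure {α β : Type*} {s : Set (Equiv.Perm α)} {F : α → β}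
    (hF : ∀ g ∈ s, ∀ q, F (g q) = F q) {g : Equiv.Perm α} (hg : g ∈ Subgroup.closure s) (q : α) :
    F (g q) = F q := by
  induction hg using Subgroup.closure_induction generalizing q with
  | mem x hx => exact hF x hx q
  | one => rfl
  | mul x y _ _ hx hy => rw [Equiv.Perm.mul_apply, hx, hy]
  | inv x _ hx =>
    have := hx (x⁻¹ q)
    rw [← this]
    exact congrArg F (x.apply_symm_apply q)

/-- The glide length of the Klein bottle in the `y`-direction. -/
noncomputable def glideLength (n m : ℤ) : ℝ := √2 * m * paramB n m * Real.pi / 3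

theorem glideLength_pos {n m : ℤ} (hm : 0 < m) (hmn : m < n) : 0 < glideLength n m := by
  have hm' : (0 : ℝ) < m := by exact_mod_cast hm
  have := paramB_pos hm hmn
  have := Real.pi_pos
  unfold glideLength
  positivity

theorem kleinGroup_eq (n m : ℤ) : kleinGroup n m = Subgroup.closure
    {translationX (4 * quarterPeriod n m), glideReflection (glideLength n m)} := by
  rw [kleinGroup, quarterPeriod, glideLength, mul_div_assoc]

/-- Functions on the quotient are functions on the plane fixed by the two generators, and
multiplying the eigenvalue equation by the positive conformal factor clears the denominator. -/
theorem mem_kleinPositiveEigenvalues {n m : ℤ} (hm : 0 < m) (hmn : m < n) {lam : ℝ} :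
    lam ∈ kleinPositiveEigenvalues n m ↔ 0 < lam ∧ ∃ F : ℝ × ℝ → ℝ, F ≠ 0 ∧ ContDiff ℝ ∞ F ∧
      (∀ x y, F (x + 4 * quarterPeriod n m, y) = F (x, y)) ∧
      (∀ x y, F (-x, y + glideLength n m) = F (x, y)) ∧
      ∀ q, pderiv 0 (pderiv 0 F) q + pderiv 1 (pderiv 1 F) q +
        lam * conformalFactor n m q.1 * F q = 0 := by
  have hL : ∀ (f : ℝ × ℝ → ℝ) (q : ℝ × ℝ), laplaceBeltrami (kleinMetric n m) f q + lam * f q = 0 ↔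
      pderiv 0 (pderiv 0 f) q + pderiv 1 (pderiv 1 f) q +
        lam * conformalFactor n m q.1 * f q = 0 := fun f q => by
    have h := conformalFactor_pos hm hmn q.1
    rw [laplaceBeltrami_conformal (ρ := fun q => conformalFactor n m q.1)
      (fun q => conformalFactor_pos hm hmn q.1) (kleinMetric_eq hm hmn)]
    rw [← mul_right_inj' h.ne', mul_zero, mul_add, ← mul_assoc, mul_inv_cancel₀ h.ne', one_mul,
      ← mul_assoc, mul_comm (conformalFactor n m q.1)]
  constructor
  · rintro ⟨hlam, f, hf0, hf, heq⟩
    have hinv : ∀ g ∈ kleinGroup n m, ∀ q, (f ∘ PlaneQuotient.proj (kleinGroup n m)) (g q) =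
        (f ∘ PlaneQuotient.proj (kleinGroup n m)) q := fun g hg q => by
      refine congrArg f (Quotient.sound ?_)
      exact ⟨⟨g, hg⟩, rfl⟩
    have hgen : kleinGroup n m = _ := kleinGroup_eq n m
    refine ⟨hlam, _, ?_, hf, fun x y => ?_, fun x y => ?_, fun q => (hL _ q).1 (heq q)⟩
    · intro h
      apply hf0
      ext z
      induction z using Quotient.inductionOn with
      | _ q => exact congrFun h q
    · exact hinv (translationX (4 * quarterPeriod n m))
        (hgen ▸ Subgroup.subset_closure (Set.mem_insert _ _)) (x, y)
    · exact hinv (glideReflection (glideLength n m))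
        (hgen ▸ Subgroup.subset_closure (Set.mem_insert_of_mem _ rfl)) (x, y)
  · rintro ⟨hlam, F, hF0, hF, hx, hy, heq⟩
    have hinv : ∀ g ∈ kleinGroup n m, ∀ q, F (g q) = F q := fun g hg q => by
      rw [kleinGroup_eq] at hg
      refine apply_smul_eq_of_mem_closure ?_ hg q
      rintro g (rfl | rfl) ⟨x, y⟩
      exacts [hx x y, hy x y]
    let f : PlaneQuotient (kleinGroup n m) → ℝ :=
      Quotient.lift F (by rintro a b ⟨g, rfl⟩; exact hinv g.1 g.2 b)
    have hfF : f ∘ PlaneQuotient.proj (kleinGroup n m) = F := rfl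
    refine ⟨hlam, f, ?_, hF, fun q => (hL F q).2 (heq q)⟩
    rintro h
    apply hF0
    rw [← hfF, h]
    rfl

/-! ### The area -/

/-- The glide reflection conjugates the translation to its inverse, so every word reduces to a power
of the translation times a power of the glide. The sign (−1)^k records the parity of the number of
reflections. -/
theorem exists_normal_form {a c : ℝ} {g : Equiv.Perm (ℝ × ℝ)}
    (hg : g ∈ Subgroup.closure {translationX a, glideReflection c}) :
    ∃ j k : ℤ, ∀ q, g q = ((k.negOnePow : ℤ) * q.1 + j * a, q.2 + k * c) := by
  induction hg using Subgroup.closure_induction with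
  | mem x hx =>
    rcases hx with rfl | rfl
    · exact ⟨1, 0, fun q => by simp [translationX]⟩
    · exact ⟨0, 1, fun q => by simp [glideReflection]⟩
  | one => exact ⟨0, 0, fun q => by simp⟩
  | mul x y _ _ hx hy =>
    obtain ⟨j, k, h⟩ := hx
    obtain ⟨j', k', h'⟩ := hy
    refine ⟨(k.negOnePow : ℤ) * j' + j, k + k', fun q => ?_⟩
    rw [Equiv.Perm.mul_apply, h', h, Int.negOnePow_add]
    ext <;> push_cast <;> ring
  | inv x _ hx =>
    obtain ⟨j, k, h⟩ := hx
    refine ⟨-(k.negOnePow : ℤ) * j, -k, fun q => ?_⟩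
    rw [Equiv.Perm.inv_eq_iff_eq, h, Int.negOnePow_neg]
    have hk : ((k.negOnePow : ℤ) : ℝ) * ((k.negOnePow : ℤ) : ℝ) = 1 := by
      rw [← Int.cast_mul, ← Units.val_mul, Int.units_mul_self]
      simp
    ext
    · push_cast
      linear_combination (j * a - q.1) * hk
    · push_cast
      ring

theorem translationX_zpow_apply (a : ℝ) (j : ℤ) (q : ℝ × ℝ) :
    (translationX a ^ j) q = (q.1 + j * a, q.2) := by
  induction j generalizing q with
  | zero => simp
  | succ i ih =>
    rw [zpow_add_one, Equiv.Perm.mul_apply, ih]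
    ext <;> simp [translationX]
    ring
  | pred i ih =>
    rw [zpow_sub_one, Equiv.Perm.mul_apply, ih]
    have : (translationX a)⁻¹ q = (q.1 - a, q.2) := rfl
    rw [this]
    ext <;> simp
    ring

theorem glideReflection_zpow_apply_snd (c : ℝ) (k : ℤ) (q : ℝ × ℝ) :
    ((glideReflection c ^ k) q).2 = q.2 + k * c := by
  induction k generalizing q with
  | zero => simp
  | succ i ih =>
    rw [zpow_add_one, Equiv.Perm.mul_apply, ih]
    simp [glideReflection]
    ring
  | pred i ih =>
    rw [zpow_sub_one, Equiv.Perm.mul_apply, ih]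
    have : (glideReflection c)⁻¹ q = (-q.1, q.2 - c) := rfl
    rw [this]
    simp
    ring

theorem exists_add_int_mul_mem_Ico {c : ℝ} (hc : 0 < c) (y : ℝ) :
    ∃ k : ℤ, y + k * c ∈ Set.Ico 0 c := by
  refine ⟨-⌊y / c⌋, ?_⟩
  have h1 := Int.floor_le (y / c)
  have h2 := Int.lt_floor_add_one (y / c)
  rw [le_div_iff₀ hc] at h1
  rw [div_lt_iff₀ hc] at h2
  push_cast
  constructor <;> linarith

theorem int_eq_of_add_mul_mem_Ico {c y : ℝ} {k k' : ℤ}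
    (h : y + k * c ∈ Set.Ico 0 c) (h' : y + k' * c ∈ Set.Ico 0 c) : k = k' := by
  have hc : 0 < c := h.1.trans_lt h.2
  have h1 : ((k - k' : ℤ) : ℝ) * c < 1 * c := by push_cast; linarith [h.2, h'.1]
  have h2 : ((k' - k : ℤ) : ℝ) * c < 1 * c := by push_cast; linarith [h'.2, h.1]
  have h3 : k - k' < 1 := by exact_mod_cast lt_of_mul_lt_mul_right h1 hc.le
  have h4 : k' - k < 1 := by exact_mod_cast lt_of_mul_lt_mul_right h2 hc.le
  lia

/-- A power of the glide brings y into its interval, after which a translation adjusts x without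
moving y. For uniqueness, y determines k, then x determines j, and the normal form depends only on j
and k. -/
theorem isFundamentalDomain_Ico_prod_Ico {a c : ℝ} (ha : 0 < a) (hc : 0 < c)
    {G : Subgroup (Equiv.Perm (ℝ × ℝ))}
    (hG : G = Subgroup.closure {translationX a, glideReflection c}) (ν : Measure (ℝ × ℝ)) :
    IsFundamentalDomain G (Set.Ico 0 a ×ˢ Set.Ico 0 c) ν := by
  have ht : translationX a ∈ G := hG ▸ Subgroup.subset_closure (Set.mem_insert _ _)
  have hr : glideReflection c ∈ G :=
    hG ▸ Subgroup.subset_closure (Set.mem_insert_of_mem _ rfl)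
  have hform : ∀ g ∈ G, ∃ j k : ℤ, ∀ q, g q = ((k.negOnePow : ℤ) * q.1 + j * a, q.2 + k * c) :=
    fun g hg => exists_normal_form (hG ▸ hg)
  clear hG
  refine IsFundamentalDomain.mk' (measurableSet_Ico.prod measurableSet_Ico).nullMeasurableSet
    fun q => ?_
  obtain ⟨k, hk⟩ := exists_add_int_mul_mem_Ico hc q.2
  obtain ⟨j, hj⟩ := exists_add_int_mul_mem_Ico ha ((glideReflection c ^ k) q).1
  have hex : ∃ g ∈ G, g q ∈ Set.Ico 0 a ×ˢ Set.Ico 0 c := by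
    refine ⟨translationX a ^ j * glideReflection c ^ k, mul_mem (zpow_mem ht _) (zpow_mem hr _), ?_⟩
    rw [Equiv.Perm.mul_apply, translationX_zpow_apply, glideReflection_zpow_apply_snd]
    exact Set.mk_mem_prod hj hk
  obtain ⟨g0, hg0, hmem⟩ := hex
  refine ⟨⟨g0, hg0⟩, hmem, ?_⟩
  rintro ⟨g, hgG⟩ (hg : g q ∈ _)
  obtain ⟨j1, k1, h1⟩ := hform g hgG
  obtain ⟨j2, k2, h2⟩ := hform g0 hg0
  rw [h1] at hg
  rw [h2] at hmem
  obtain rfl := int_eq_of_add_mul_mem_Ico hg.2 hmem.2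
  obtain rfl := int_eq_of_add_mul_mem_Ico hg.1 hmem.1
  exact Subtype.ext (Equiv.ext fun q => by rw [h1, h2])

theorem countable_closure_glide (a c : ℝ) :
    Countable (Subgroup.closure {translationX a, glideReflection c}) := by
  choose j k h using fun g : Subgroup.closure {translationX a, glideReflection c} =>
    exists_normal_form g.2
  refine Function.Injective.countable (f := fun g => (j g, k g)) fun g g' hgg => ?_
  obtain ⟨h1, h2⟩ := Prod.ext_iff.1 hgg
  simp only at h1 h2
  exact Subtype.ext (Equiv.ext fun q => by rw [h, h, h1, h2])

theorem measurePreserving_withDensity {α : Type*} [MeasurableSpace α] {μ : Measure α} {g : α → α}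
    (hg : MeasurePreserving g μ μ) {f : α → ENNReal} (hf : Measurable f) (hfg : ∀ x, f (g x) = f x) :
    MeasurePreserving g (μ.withDensity f) (μ.withDensity f) := by
  refine ⟨hg.measurable, Measure.ext fun s hs => ?_⟩
  rw [Measure.map_apply hg.measurable hs, withDensity_apply _ (hg.measurable hs),
    withDensity_apply _ hs, ← hg.setLIntegral_comp_preimage hs hf]
  simp only [hfg]

theorem measurePreserving_of_mem_closure {a c : ℝ} {ρ : ℝ → ENNReal} (hρ : Measurable ρ)
    (ha : ∀ x, ρ (x + a) = ρ x) (hneg : ∀ x, ρ (-x) = ρ x) {g : Equiv.Perm (ℝ × ℝ)}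
    (hg : g ∈ Subgroup.closure {translationX a, glideReflection c}) :
    MeasurePreserving g (volume.withDensity fun q : ℝ × ℝ => ρ q.1)
      (volume.withDensity fun q : ℝ × ℝ => ρ q.1) := by
  induction hg using Subgroup.closure_induction with
  | mem x hx =>
    rcases hx with rfl | rfl
    · refine measurePreserving_withDensity ?_ (hρ.comp measurable_fst) fun q => ha q.1
      exact (measurePreserving_add_right volume a).prod (MeasurePreserving.id volume)
    · refine measurePreserving_withDensity ?_ (hρ.comp measurable_fst) fun q => hneg q.1
      exact (Measure.measurePreserving_neg volume).prod (measurePreserving_add_right volume c)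
  | one => exact MeasurePreserving.id _
  | mul x y _ _ hx hy => exact hx.comp hy
  | inv x hx' hx =>
    -- Measurability of a permutation does not pass formally to its inverse; here the normal form
    -- exhibits the inverse as an affine map.
    have hm : Measurable (x⁻¹ : Equiv.Perm (ℝ × ℝ)) := by
      obtain ⟨j, k, h⟩ := exists_normal_form (inv_mem hx')
      rw [funext h]
      fun_prop
    refine ⟨hm, ?_⟩
    conv_lhs => rw [← hx.map_eq, Measure.map_map hm hx.measurable]
    convert! Measure.map_id
    ext1 q
    exact x.symm_apply_apply q

/-- Reflection in `a` folds [a, 2a] onto [0, a], and [2a, 4a] is one further period. -/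
theorem integral_quarter_period {f : ℝ → ℝ} (hf : Continuous f) {a : ℝ}
    (hs : ∀ x, f (2 * a - x) = f x) (hp : Function.Periodic f (2 * a)) :
    ∫ x in (0 : ℝ)..4 * a, f x = 4 * ∫ x in (0 : ℝ)..a, f x := by
  have hi : ∀ u v, IntervalIntegrable f volume u v := fun u v => hf.intervalIntegrable u v
  have h1 : ∫ x in a..2 * a, f x = ∫ x in (0 : ℝ)..a, f x := by
    have := intervalIntegral.integral_comp_sub_left f (2 * a) (a := 0) (b := a)
    simp only [hs] at this
    rw [this]
    congr 1 <;> ring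
  have h2 : ∫ x in 2 * a..4 * a, f x = ∫ x in (0 : ℝ)..2 * a, f x := by
    have := hp.intervalIntegral_add_eq (2 * a) 0
    rwa [zero_add, show 2 * a + 2 * a = 4 * a by ring] at this
  rw [← intervalIntegral.integral_add_adjacent_intervals (hi 0 (2 * a)) (hi (2 * a) (4 * a)), h2,
    ← intervalIntegral.integral_add_adjacent_intervals (hi 0 a) (hi a (2 * a)), h1]
  ring

theorem integral_conformalFactor {n m : ℤ} (hm : 0 < m) (hmn : m < n) :
    ∫ x in (0 : ℝ)..4 * quarterPeriod n m, conformalFactor n m x =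
      4 * paramR n m * (ellipticE (modulus n m) - m / (n + 2 * m) * ellipticK (modulus n m)) := by
  have hm' : (0 : ℝ) < m := by exact_mod_cast hm
  have hmn' : (m : ℝ) < n := by exact_mod_cast hmn
  have hn' : (0 : ℝ) < n := hm'.trans hmn'
  have hp0 := modulus_nonneg n m
  have hp1 := modulus_lt_one hm hmn
  have hr := paramR_pos hm hmn
  rw [integral_quarter_period (contDiff_conformalFactor hm hmn).continuous
    (conformalFactor_two_mul_sub hm hmn) (conformalFactor_periodic hm hmn)]
  -- Since (n+m)/(n+2m) = 1 − m/(n+2m), the conformal factor is r²(dn² − m/(n+2m)).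
  have h1 : ∀ x, conformalFactor n m x = paramR n m ^ 2 *
      (fun t => jacobiDn (modulus n m) t ^ 2 - (m : ℝ) / (n + 2 * m)) (paramR n m * x) := fun x => by
    simp only [conformalFactor, jacobiDn_sq hp0 hp1]
    field_simp
    ring
  have hc : Continuous (jacobiDn (modulus n m)) :=
    continuous_iff_continuousAt.2 fun x => (hasDerivAt_jacobiDn hp0 hp1 x).continuousAt
  simp only [h1, intervalIntegral.integral_const_mul]
  rw [intervalIntegral.integral_comp_mul_left (fun t => jacobiDn (modulus n m) t ^ 2 -
    (m : ℝ) / (n + 2 * m)) hr.ne', mul_zero, paramR_mul_quarterPeriod hm hmn,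
    intervalIntegral.integral_sub (f := fun t => jacobiDn (modulus n m) t ^ 2)
      ((hc.pow 2).intervalIntegrable _ _)
      intervalIntegrable_const, integral_jacobiDn_sq hp0 hp1]
  simp only [intervalIntegral.integral_const, smul_eq_mul, sub_zero]
  field_simp

theorem glideLength_mul_paramR {n m : ℤ} (hm : 0 < m) (hmn : m < n) :
    glideLength n m * paramR n m = Real.pi / 3 * (√(n : ℝ) * √((n : ℝ) + 2 * m)) := by
  have hm' : (0 : ℝ) < m := by exact_mod_cast hm
  have hmn' : (m : ℝ) < n := by exact_mod_cast hmn
  have hn' : (0 : ℝ) < n := hm'.trans hmn'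
  have hb := paramB_pos hm hmn
  rw [← Real.sqrt_mul hn'.le, paramR, Real.sqrt_div (mul_nonneg hn'.le (by positivity)), glideLength,
    show 2 * paramB n m ^ 2 * (m : ℝ) ^ 2 = 2 * (paramB n m * m) ^ 2 by ring,
    Real.sqrt_mul zero_le_two, Real.sqrt_sq (by positivity)]
  have : 0 < √(2 : ℝ) := Real.sqrt_pos.2 (by norm_num)
  field_simp

theorem kleinArea_eq {n m : ℤ} (hm : 0 < m) (hmn : m < n) :
    kleinArea n m = ENNReal.ofReal (4 * Real.pi * √(n : ℝ) / (3 * √((n : ℝ) + 2 * m)) *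
      (((n : ℝ) + 2 * m) * ellipticE (modulus n m) - m * ellipticK (modulus n m))) := by
  have hm' : (0 : ℝ) < m := by exact_mod_cast hm
  have hmn' : (m : ℝ) < n := by exact_mod_cast hmn
  have hn' : (0 : ℝ) < n := hm'.trans hmn'
  have hA := quarterPeriod_pos hm hmn
  have hc := glideLength_pos hm hmn
  have hcont := (contDiff_conformalFactor hm hmn).continuous
  have hν : areaMeasure (kleinMetric n m) = volume.withDensity
      fun q : ℝ × ℝ => ENNReal.ofReal (conformalFactor n m q.1) := by
    unfold areaMeasure areaDensity
    simp only [kleinMetric_eq hm hmn, Matrix.det_fin_two_of, mul_zero, sub_zero,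
      Real.sqrt_mul_self (conformalFactor_pos hm hmn _).le]
  have hmeas : Measurable fun x => ENNReal.ofReal (conformalFactor n m x) := by fun_prop
  have hper : ∀ x, conformalFactor n m (x + 4 * quarterPeriod n m) = conformalFactor n m x :=
    fun x => by
      have h := (conformalFactor_periodic hm hmn).nsmul 2 x
      rw [← h]
      congr 2
      simp
      ring
  rw [kleinArea, quotientArea, hν, kleinGroup_eq]
  set G := Subgroup.closure {translationX (4 * quarterPeriod n m), glideReflection (glideLength n m)}
    with hG
  set ν := volume.withDensity fun q : ℝ × ℝ => ENNReal.ofReal (conformalFactor n m q.1) with hνdef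
  have hmp : ∀ g : G, MeasurePreserving g.1 ν ν := fun g =>
    measurePreserving_of_mem_closure hmeas (fun x => by rw [hper])
      (fun x => by rw [conformalFactor_neg hm hmn]) g.2
  have : Countable G := by
    rw [hG]
    exact countable_closure_glide _ _
  have : MeasurableConstSMul G (ℝ × ℝ) := ⟨fun g => (hmp g).measurable⟩
  have : SMulInvariantMeasure G (ℝ × ℝ) ν := ⟨fun g s hs => (hmp g).measure_preimage
    hs.nullMeasurableSet⟩
  rw [(isFundamentalDomain_Ico_prod_Ico (by positivity) hc hG ν).covolume_eq_volume ν, hνdef,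
    withDensity_apply _ (measurableSet_Ico.prod measurableSet_Ico), Measure.volume_eq_prod,
    ← Measure.prod_restrict]
  have hprod := lintegral_prod_mul (μ := volume.restrict (Set.Ico 0 (4 * quarterPeriod n m)))
    (ν := volume.restrict (Set.Ico 0 (glideLength n m))) (hmeas.aemeasurable)
    (g := fun _ => 1) aemeasurable_const
  simp only [mul_one] at hprod
  rw [hprod, lintegral_one, Measure.restrict_apply_univ, Real.volume_Ico, sub_zero,
    ← ofReal_integral_eq_lintegral_ofReal, ← ENNReal.ofReal_mul, integral_Ico_eq_integral_Ioc,
    ← intervalIntegral.integral_of_le (by positivity), integral_conformalFactor hm hmn]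
  · congr 1
    have h1 := glideLength_mul_paramR hm hmn
    have h2 : √((n : ℝ) + 2 * m) ^ 2 = n + 2 * m := Real.sq_sqrt (by positivity)
    have h3 : 0 < √((n : ℝ) + 2 * m) := Real.sqrt_pos.2 (by positivity)
    rw [mul_right_comm, mul_assoc 4, mul_comm (paramR n m), h1]
    field_simp
    rw [h2]
  · exact integral_nonneg fun x => (conformalFactor_pos hm hmn x).le
  · exact (hcont.integrableOn_Icc).mono_set Set.Ico_subset_Icc_self
  · exact Filter.Eventually.of_forall fun x => (conformalFactor_pos hm hmn x).le

/-! ### Integrals over rectangles and the Poincaré inequality -/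

/-- The closed rectangle `[a, b] × [c, d]`. -/
def rect (a b c d : ℝ) : Set (ℝ × ℝ) := Set.Icc a b ×ˢ Set.Icc c d

theorem isCompact_rect (a b c d : ℝ) : IsCompact (rect a b c d) := isCompact_Icc.prod isCompact_Icc

theorem integrableOn_rect {f : ℝ × ℝ → ℝ} (hf : Continuous f) (a b c d : ℝ) :
    IntegrableOn f (rect a b c d) :=
  hf.continuousOn.integrableOn_compact (isCompact_rect a b c d)

theorem integral_rect_eq {f : ℝ × ℝ → ℝ} (hf : Continuous f) {a b c d : ℝ} (hab : a ≤ b)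
    (hcd : c ≤ d) : ∫ q in rect a b c d, f q = ∫ x in a..b, ∫ y in c..d, f (x, y) := by
  have h := integrableOn_rect hf a b c d
  rw [rect, Measure.volume_eq_prod] at *
  rw [setIntegral_prod f h, integral_Icc_eq_integral_Ioc, intervalIntegral.integral_of_le hab]
  simp only [integral_Icc_eq_integral_Ioc, intervalIntegral.integral_of_le hcd]

theorem integral_rect_eq_swap {f : ℝ × ℝ → ℝ} (hf : Continuous f) {a b c d : ℝ} (hab : a ≤ b)
    (hcd : c ≤ d) : ∫ q in rect a b c d, f q = ∫ y in c..d, ∫ x in a..b, f (x, y) := by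
  have h1 := integral_rect_eq (f := fun z => f z.swap) (hf.comp continuous_swap) hcd hab
  have h2 := setIntegral_prod_swap (μ := volume) (ν := volume) (Set.Icc a b) (Set.Icc c d) f
  rw [← Measure.volume_eq_prod] at h2
  rw [rect] at h1 ⊢
  rw [← h2, h1]
  rfl

theorem hasDerivAt_fst {f : ℝ × ℝ → ℝ} {q : ℝ × ℝ} (hf : DifferentiableAt ℝ f q) :
    HasDerivAt (fun x => f (x, q.2)) (pderiv 0 f q) q.1 := by
  have h1 : HasDerivAt (fun x : ℝ => (x, q.2)) ((1 : ℝ), (0 : ℝ)) q.1 :=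
    (hasDerivAt_id q.1).prodMk (hasDerivAt_const q.1 q.2)
  exact HasFDerivAt.comp_hasDerivAt q.1 (f := fun x : ℝ => (x, q.2)) hf.hasFDerivAt h1

theorem hasDerivAt_snd {f : ℝ × ℝ → ℝ} {q : ℝ × ℝ} (hf : DifferentiableAt ℝ f q) :
    HasDerivAt (fun y => f (q.1, y)) (pderiv 1 f q) q.2 := by
  have h1 : HasDerivAt (fun y : ℝ => (q.1, y)) ((0 : ℝ), (1 : ℝ)) q.2 :=
    (hasDerivAt_const q.2 q.1).prodMk (hasDerivAt_id q.2)
  exact HasFDerivAt.comp_hasDerivAt q.2 (f := fun y : ℝ => (q.1, y)) hf.hasFDerivAt h1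

/-- Cauchy–Schwarz against the constant 1, obtained by expanding the square of (b − a)g minus its
integral. -/
theorem sq_integral_le {g : ℝ → ℝ} (hg : Continuous g) {a b : ℝ} (hab : a ≤ b) :
    (∫ x in a..b, g x) ^ 2 ≤ (b - a) * ∫ x in a..b, g x ^ 2 := by
  rcases hab.eq_or_lt with rfl | hab
  · simp
  set M := ∫ x in a..b, g x with hM
  have h : 0 ≤ ∫ x in a..b, ((b - a) * g x - M) ^ 2 :=
    intervalIntegral.integral_nonneg hab.le fun x _ => sq_nonneg _
  have e : ∫ x in a..b, ((b - a) * g x - M) ^ 2 =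
      (b - a) ^ 2 * (∫ x in a..b, g x ^ 2) - 2 * (b - a) * M * M + (b - a) * M ^ 2 := by
    have : ∀ x, ((b - a) * g x - M) ^ 2 =
        (b - a) ^ 2 * g x ^ 2 - 2 * (b - a) * M * g x + M ^ 2 := fun x => by ring
    simp only [this]
    rw [intervalIntegral.integral_add, intervalIntegral.integral_sub,
      intervalIntegral.integral_const_mul, intervalIntegral.integral_const_mul, ← hM,
      intervalIntegral.integral_const, smul_eq_mul]
    all_goals exact Continuous.intervalIntegrable (by fun_prop) _ _
  rw [e] at h
  have hpos : 0 < b - a := sub_pos.2 hab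
  refine le_of_mul_le_mul_left ?_ hpos
  linarith

/-- One-dimensional Poincaré inequality with a non-sharp constant. A continuous function attains its
mean at some ξ, and g(x) − g(ξ) is an integral of g', controlled by Cauchy–Schwarz. Expanding ∫(g −
g(ξ))² gives the claim. -/
theorem integral_sq_le_of_hasDerivAt {g g' : ℝ → ℝ} (hg : ∀ x, HasDerivAt g (g' x) x)
    (hg' : Continuous g') {a b : ℝ} (hab : a < b) :
    ∫ x in a..b, g x ^ 2 ≤
      (b - a)⁻¹ * (∫ x in a..b, g x) ^ 2 + (b - a) ^ 2 * ∫ x in a..b, g' x ^ 2 := by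
  have hc : Continuous g := continuous_iff_continuousAt.2 fun x => (hg x).continuousAt
  have hpos : 0 < b - a := sub_pos.2 hab
  obtain ⟨ξ, hξ, hm⟩ := exists_eq_interval_average hab.ne hc.continuousOn
  rw [interval_average_eq, smul_eq_mul] at hm
  rw [Set.uIoo_of_le hab.le] at hξ
  set J := ∫ x in a..b, g' x ^ 2 with hJ
  have hi : ∀ u v, IntervalIntegrable (fun x => g' x ^ 2) volume u v := fun u v =>
    Continuous.intervalIntegrable (by fun_prop) _ _
  have hsub : ∀ u v, a ≤ u → u ≤ v → v ≤ b → (g v - g u) ^ 2 ≤ (b - a) * J := fun u v hu huv hv => by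
    rw [← intervalIntegral.integral_eq_sub_of_hasDerivAt (fun x _ => hg x)
      (hg'.intervalIntegrable _ _)]
    refine (sq_integral_le hg' huv).trans (mul_le_mul (by linarith) ?_ ?_ hpos.le)
    · exact intervalIntegral.integral_mono_interval hu huv hv
        (Filter.Eventually.of_forall fun x => sq_nonneg _) (hi _ _)
    · exact intervalIntegral.integral_nonneg huv fun x _ => sq_nonneg _
  have hpt : ∀ x ∈ Set.Icc a b, (g x - g ξ) ^ 2 ≤ (b - a) * J := fun x hx => by
    rcases le_total ξ x with h | h
    · exact hsub ξ x hξ.1.le h hx.2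
    · rw [← neg_sub, neg_sq]
      exact hsub x ξ hx.1 h hξ.2.le
  have hint : ∫ x in a..b, (g x - g ξ) ^ 2 ≤ ∫ _ in a..b, (b - a) * J :=
    intervalIntegral.integral_mono_on hab.le (Continuous.intervalIntegrable (by fun_prop) _ _)
      intervalIntegrable_const hpt
  have e : ∫ x in a..b, (g x - g ξ) ^ 2 =
      (∫ x in a..b, g x ^ 2) - 2 * g ξ * (∫ x in a..b, g x) + (b - a) * g ξ ^ 2 := by
    have : ∀ x, (g x - g ξ) ^ 2 = g x ^ 2 - 2 * g ξ * g x + g ξ ^ 2 := fun x => by ring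
    simp only [this]
    rw [intervalIntegral.integral_add, intervalIntegral.integral_sub,
      intervalIntegral.integral_const_mul, intervalIntegral.integral_const, smul_eq_mul]
    all_goals exact Continuous.intervalIntegrable (by fun_prop) _ _
  rw [e, intervalIntegral.integral_const, smul_eq_mul, hm] at hint
  have e2 : (b - a) * ((b - a)⁻¹ * ∫ x in a..b, g x) ^ 2 = (b - a)⁻¹ * (∫ x in a..b, g x) ^ 2 := by
    field_simp
  have e3 : 2 * ((b - a)⁻¹ * ∫ x in a..b, g x) * (∫ x in a..b, g x) =
      2 * ((b - a)⁻¹ * (∫ x in a..b, g x) ^ 2) := by ring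
  rw [e2, e3] at hint
  linarith

theorem hasDerivAt_integral_fst {f : ℝ × ℝ → ℝ} (hf : ContDiff ℝ ∞ f) (a b y : ℝ) :
    HasDerivAt (fun y => ∫ x in a..b, f (x, y)) (∫ x in a..b, pderiv 1 f (x, y)) y := by
  have hc := hf.continuous
  have hc' := (contDiff_pderiv hf 1).continuous
  obtain ⟨C, hC⟩ := ((isCompact_uIcc (a := a) (b := b)).prod
    (isCompact_closedBall y 1)).exists_bound_of_continuousOn hc'.continuousOn
  refine (intervalIntegral.hasDerivAt_integral_of_dominated_loc_of_deriv_le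
    (F := fun y x => f (x, y)) (F' := fun y x => pderiv 1 f (x, y)) (bound := fun _ => C)
    (Metric.closedBall_mem_nhds y one_pos) (Filter.Eventually.of_forall fun y => ?_) ?_ ?_ ?_
    intervalIntegrable_const ?_).2
  · exact Continuous.aestronglyMeasurable (by fun_prop)
  · exact Continuous.intervalIntegrable (by fun_prop) _ _
  · exact Continuous.aestronglyMeasurable (by fun_prop)
  · exact Filter.Eventually.of_forall fun x hx z hz => hC (x, z) ⟨Set.uIoc_subset_uIcc hx, hz⟩
  · exact Filter.Eventually.of_forall fun x _ z _ =>
      hasDerivAt_snd (q := (x, z)) (hf.differentiable (by simp) _)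

theorem continuous_integral_fst {f : ℝ × ℝ → ℝ} (hf : Continuous f) (a b : ℝ) :
    Continuous fun y => ∫ x in a..b, f (x, y) :=
  intervalIntegral.continuous_parametric_intervalIntegral_of_continuous'
    (f := fun y x => f (x, y)) (by fun_prop) a b

theorem continuous_integral_snd {f : ℝ × ℝ → ℝ} (hf : Continuous f) (a b : ℝ) :
    Continuous fun x => ∫ y in a..b, f (x, y) :=
  intervalIntegral.continuous_parametric_intervalIntegral_of_continuous'
    (f := fun x y => f (x, y)) (by fun_prop) a b

/-- Poincaré inequality on a rectangle, for functions of mean zero. -/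
theorem poincare_rect {f : ℝ × ℝ → ℝ} (hf : ContDiff ℝ ∞ f) {a b c d : ℝ} (hab : a < b)
    (hcd : c < d) (h0 : ∫ q in rect a b c d, f q = 0) :
    ∫ q in rect a b c d, f q ^ 2 ≤ (b - a) ^ 2 * (∫ q in rect a b c d, pderiv 0 f q ^ 2) +
      (d - c) ^ 2 * ∫ q in rect a b c d, pderiv 1 f q ^ 2 := by
  have hc := hf.continuous
  have hx := (contDiff_pderiv hf 0).continuous
  have hy := (contDiff_pderiv hf 1).continuous
  have hc2 : Continuous fun q => f q ^ 2 := by fun_prop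
  have hx2 : Continuous fun q => pderiv 0 f q ^ 2 := by fun_prop
  have hy2 : Continuous fun q => pderiv 1 f q ^ 2 := by fun_prop
  have hpos : 0 < b - a := sub_pos.2 hab
  have hcx := continuous_integral_fst hx a b
  have hcy := continuous_integral_fst hy a b
  have hcf := continuous_integral_fst hc a b
  have hcfs : Continuous fun y => (∫ x in a..b, f (x, y)) ^ 2 := by fun_prop
  have hcys : Continuous fun y => (∫ x in a..b, pderiv 1 f (x, y)) ^ 2 := by fun_prop
  have hcx2 := continuous_integral_fst hx2 a b
  have hcy2 := continuous_integral_fst hy2 a b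
  have hcf2 := continuous_integral_fst hc2 a b
  rw [integral_rect_eq_swap hc hab.le hcd.le] at h0
  rw [integral_rect_eq_swap hc2 hab.le hcd.le, integral_rect_eq_swap hx2 hab.le hcd.le,
    integral_rect_eq_swap hy2 hab.le hcd.le]
  -- The one-dimensional inequality is used in x on each slice, and then in y for the slice
  -- integrals, whose total is zero by `h0`. Cauchy–Schwarz (`h3`) returns the square to the inside
  -- of the x-integral.
  have h1 : ∀ y, ∫ x in a..b, f (x, y) ^ 2 ≤ (b - a)⁻¹ * (∫ x in a..b, f (x, y)) ^ 2 +
      (b - a) ^ 2 * ∫ x in a..b, pderiv 0 f (x, y) ^ 2 := fun y =>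
    integral_sq_le_of_hasDerivAt
      (fun x => hasDerivAt_fst (q := (x, y)) (hf.differentiable (by simp) _)) (by fun_prop) hab
  have h2 := integral_sq_le_of_hasDerivAt (fun y => hasDerivAt_integral_fst hf a b y) hcy hcd
  rw [h0] at h2
  have h3 : ∫ y in c..d, (∫ x in a..b, pderiv 1 f (x, y)) ^ 2 ≤
      ∫ y in c..d, (b - a) * ∫ x in a..b, pderiv 1 f (x, y) ^ 2 :=
    intervalIntegral.integral_mono_on hcd.le (hcys.intervalIntegrable _ _)
      ((hcy2.const_mul _).intervalIntegrable _ _)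
      fun y _ => sq_integral_le (by fun_prop) hab.le
  have h4 : ∫ y in c..d, ∫ x in a..b, f (x, y) ^ 2 ≤
      ∫ y in c..d, ((b - a)⁻¹ * (∫ x in a..b, f (x, y)) ^ 2 +
        (b - a) ^ 2 * ∫ x in a..b, pderiv 0 f (x, y) ^ 2) :=
    intervalIntegral.integral_mono_on hcd.le (hcf2.intervalIntegrable _ _)
      (((hcfs.const_mul _).add (hcx2.const_mul _)).intervalIntegrable _ _) fun y _ => h1 y
  rw [intervalIntegral.integral_add ((hcfs.const_mul _).intervalIntegrable _ _)
    ((hcx2.const_mul _).intervalIntegrable _ _), intervalIntegral.integral_const_mul,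
    intervalIntegral.integral_const_mul] at h4
  rw [intervalIntegral.integral_const_mul] at h3
  have h5 := mul_le_mul_of_nonneg_left h2 (inv_nonneg.2 hpos.le)
  have h6 := mul_le_mul_of_nonneg_left h3 (mul_nonneg (inv_nonneg.2 hpos.le) (sq_nonneg (d - c)))
  have h7 : (b - a)⁻¹ * (d - c) ^ 2 *
      ((b - a) * ∫ y in c..d, ∫ x in a..b, pderiv 1 f (x, y) ^ 2) =
      (d - c) ^ 2 * ∫ y in c..d, ∫ x in a..b, pderiv 1 f (x, y) ^ 2 := by field_simp
  rw [h7] at h6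
  have h8 : ∀ z : ℝ, (b - a)⁻¹ * ((d - c)⁻¹ * 0 ^ 2 + (d - c) ^ 2 * z) =
      (b - a)⁻¹ * (d - c) ^ 2 * z := fun z => by ring
  rw [h8] at h5
  linarith

/-- The cells of the subdivision of `[0, L] × [0, H]` into `N × N` equal rectangles. -/
def cell (L H : ℝ) (N i j : ℕ) : Set (ℝ × ℝ) :=
  rect (i * (L / N)) ((i + 1 : ℕ) * (L / N)) (j * (H / N)) ((j + 1 : ℕ) * (H / N))

theorem integral_rect_eq_sum_cells {f : ℝ × ℝ → ℝ} (hf : Continuous f) {L H : ℝ} (hL : 0 < L)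
    (hH : 0 < H) {N : ℕ} (hN : 0 < N) :
    ∫ q in rect 0 L 0 H, f q =
      ∑ i ∈ Finset.range N, ∑ j ∈ Finset.range N, ∫ q in cell L H N i j, f q := by
  have hN' : (0 : ℝ) < N := by exact_mod_cast hN
  have hle : ∀ (k : ℕ) {z : ℝ}, 0 < z → (k : ℝ) * (z / N) ≤ (k + 1 : ℕ) * (z / N) := fun k z hz =>
    mul_le_mul_of_nonneg_right (by push_cast; linarith) (by positivity)
  have h0 : ∀ g : ℝ → ℝ, Continuous g → ∀ z, ∫ x in (0 : ℝ)..z, g x =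
      ∑ k ∈ Finset.range N, ∫ x in (k : ℝ) * (z / N)..(k + 1 : ℕ) * (z / N), g x := fun g hg z => by
    rw [intervalIntegral.sum_integral_adjacent_intervals (a := fun k : ℕ => (k : ℝ) * (z / N))
      fun k _ => hg.intervalIntegrable _ _]
    congr 1
    · simp
    · field_simp
  rw [integral_rect_eq hf hL.le hH.le, h0 _ (continuous_integral_snd hf 0 H)]
  refine Finset.sum_congr rfl fun i _ => ?_
  have h1 : ∀ x, ∫ y in (0 : ℝ)..H, f (x, y) = _ := fun x => h0 (fun y => f (x, y)) (by fun_prop) H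
  simp only [h1]
  rw [intervalIntegral.integral_finsetSum fun j _ =>
    (continuous_integral_snd hf _ _).intervalIntegrable _ _]
  exact Finset.sum_congr rfl fun j _ => (integral_rect_eq hf (hle i hL) (hle j hH)).symm

/-- The cells have sides L/N and H/N, so summing the cellwise Poincaré inequalities gains the factor
1/N² that later defeats any fixed spectral bound. -/
theorem integral_sq_le_of_cells {f : ℝ × ℝ → ℝ} (hf : ContDiff ℝ ∞ f) {L H : ℝ} (hL : 0 < L)
    (hH : 0 < H) {N : ℕ} (hN : 0 < N)
    (h0 : ∀ i < N, ∀ j < N, ∫ q in cell L H N i j, f q = 0) :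
    ∫ q in rect 0 L 0 H, f q ^ 2 ≤
      (L ^ 2 + H ^ 2) / N ^ 2 * ∫ q in rect 0 L 0 H, (pderiv 0 f q ^ 2 + pderiv 1 f q ^ 2) := by
  have hN' : (0 : ℝ) < N := by exact_mod_cast hN
  have hc := hf.continuous
  have hx := (contDiff_pderiv hf 0).continuous
  have hy := (contDiff_pderiv hf 1).continuous
  have hc2 : Continuous fun q => f q ^ 2 := by fun_prop
  have hx2 : Continuous fun q => pderiv 0 f q ^ 2 := by fun_prop
  have hy2 : Continuous fun q => pderiv 1 f q ^ 2 := by fun_prop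
  have hlt : ∀ (k : ℕ) {z : ℝ}, 0 < z → (k : ℝ) * (z / N) < (k + 1 : ℕ) * (z / N) := fun k z hz =>
    mul_lt_mul_of_pos_right (by push_cast; linarith) (by positivity)
  rw [integral_rect_eq_sum_cells hc2 hL hH hN,
    integral_rect_eq_sum_cells (hx2.fun_add hy2) hL hH hN, Finset.mul_sum]
  refine Finset.sum_le_sum fun i hi => ?_
  rw [Finset.mul_sum]
  refine Finset.sum_le_sum fun j hj => ?_
  have h := poincare_rect hf (hlt i hL) (hlt j hH)
    (h0 i (Finset.mem_range.1 hi) j (Finset.mem_range.1 hj))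
  have hA : 0 ≤ ∫ q in cell L H N i j, pderiv 0 f q ^ 2 := integral_nonneg fun q => sq_nonneg _
  have hB : 0 ≤ ∫ q in cell L H N i j, pderiv 1 f q ^ 2 := integral_nonneg fun q => sq_nonneg _
  have e : ∫ q in cell L H N i j, (pderiv 0 f q ^ 2 + pderiv 1 f q ^ 2) =
      (∫ q in cell L H N i j, pderiv 0 f q ^ 2) + ∫ q in cell L H N i j, pderiv 1 f q ^ 2 :=
    integral_add (integrableOn_rect hx2 _ _ _ _) (integrableOn_rect hy2 _ _ _ _)
  rw [e]
  have e1 : ∀ (k : ℕ) (z : ℝ), (((k + 1 : ℕ) : ℝ) * (z / N) - k * (z / N)) ^ 2 = z ^ 2 / N ^ 2 :=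
    fun k z => by push_cast; ring
  rw [e1, e1] at h
  refine h.trans ?_
  rw [mul_add]
  exact add_le_add (mul_le_mul_of_nonneg_right (by gcongr; nlinarith) hA)
    (mul_le_mul_of_nonneg_right (by gcongr; nlinarith) hB)

/-! ### Eigenfunctions on a flat torus with a conformal factor -/

theorem pderiv_mul {f h : ℝ × ℝ → ℝ} (hf : ContDiff ℝ ∞ f) (hh : ContDiff ℝ ∞ h) (i : Fin 2)
    (q : ℝ × ℝ) :
    pderiv i (fun q => f q * h q) q = f q * pderiv i h q + pderiv i f q * h q := by
  have hf' : DifferentiableAt ℝ f q := hf.differentiable (by simp) q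
  have hh' : DifferentiableAt ℝ h q := hh.differentiable (by simp) q
  rw [pderiv, fderiv_fun_mul hf' hh']
  simp [pderiv, mul_comm]

theorem pderiv_sum {ι : Type*} (s : Finset ι) (c : ι → ℝ) {f : ι → ℝ × ℝ → ℝ}
    (hf : ∀ k, ContDiff ℝ ∞ (f k)) (i : Fin 2) (q : ℝ × ℝ) :
    pderiv i (fun q => ∑ k ∈ s, c k * f k q) q = ∑ k ∈ s, c k * pderiv i (f k) q := by
  have hd : ∀ k, DifferentiableAt ℝ (f k) q := fun k => (hf k).differentiable (by simp) q
  rw [pderiv, fderiv_fun_sum fun k _ => (hd k).const_mul (c k)]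
  simp [pderiv, fderiv_const_mul (hd _)]

theorem pderiv_periodic {f : ℝ × ℝ → ℝ} {v : ℝ × ℝ} (hf : Function.Periodic f v) (i : Fin 2) :
    Function.Periodic (pderiv i f) v := fun q => by
  rw [pderiv, pderiv, ← fderiv_comp_add_right]
  simp only [hf _]

theorem integral_pderiv_zero {f : ℝ × ℝ → ℝ} (hf : ContDiff ℝ ∞ f) {L H : ℝ} (hL : 0 ≤ L)
    (hH : 0 ≤ H) (hp : Function.Periodic f (L, 0)) : ∫ q in rect 0 L 0 H, pderiv 0 f q = 0 := by
  have hc := (contDiff_pderiv hf 0).continuous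
  rw [integral_rect_eq_swap hc hL hH]
  have : ∀ y, ∫ x in (0 : ℝ)..L, pderiv 0 f (x, y) = 0 := fun y => by
    rw [intervalIntegral.integral_eq_sub_of_hasDerivAt (f := fun x => f (x, y))
      (fun x _ => hasDerivAt_fst (q := (x, y)) (hf.differentiable (by simp) _))
      (Continuous.intervalIntegrable (by fun_prop) _ _)]
    have := hp (0, y)
    rw [Prod.mk_add_mk, zero_add, add_zero] at this
    rw [this, sub_self]
  simp [this]

theorem integral_pderiv_one {f : ℝ × ℝ → ℝ} (hf : ContDiff ℝ ∞ f) {L H : ℝ} (hL : 0 ≤ L)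
    (hH : 0 ≤ H) (hp : Function.Periodic f (0, H)) : ∫ q in rect 0 L 0 H, pderiv 1 f q = 0 := by
  have hc := (contDiff_pderiv hf 1).continuous
  rw [integral_rect_eq hc hL hH]
  have : ∀ x, ∫ y in (0 : ℝ)..H, pderiv 1 f (x, y) = 0 := fun x => by
    rw [intervalIntegral.integral_eq_sub_of_hasDerivAt (f := fun y => f (x, y))
      (fun y _ => hasDerivAt_snd (q := (x, y)) (hf.differentiable (by simp) _))
      (Continuous.intervalIntegrable (by fun_prop) _ _)]
    have := hp (x, 0)
    rw [Prod.mk_add_mk, zero_add, add_zero] at this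
    rw [this, sub_self]
  simp [this]

/-- `F` is a nonzero smooth function on the torus `ℝ² / (Lℤ × Hℤ)` with
`F_xx + F_yy + lam ρ F = 0`. -/
structure IsTorusEigenfunction (ρ : ℝ × ℝ → ℝ) (L H lam : ℝ) (F : ℝ × ℝ → ℝ) : Prop where
  ne_zero : F ≠ 0
  contDiff : ContDiff ℝ ∞ F
  periodic_fst : Function.Periodic F (L, 0)
  periodic_snd : Function.Periodic F (0, H)
  eq : ∀ q, pderiv 0 (pderiv 0 F) q + pderiv 1 (pderiv 1 F) q + lam * ρ q * F q = 0

/-- The divergence of F∇G has integral zero over a period rectangle, and the equation for G replaces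
its flat Laplacian. -/
theorem IsTorusEigenfunction.green {ρ : ℝ × ℝ → ℝ} {L H lam lam' : ℝ} {F G : ℝ × ℝ → ℝ}
    (hF : IsTorusEigenfunction ρ L H lam F) (hG : IsTorusEigenfunction ρ L H lam' G)
    (hL : 0 ≤ L) (hH : 0 ≤ H) :
    ∫ q in rect 0 L 0 H, (pderiv 0 F q * pderiv 0 G q + pderiv 1 F q * pderiv 1 G q) =
      lam' * ∫ q in rect 0 L 0 H, ρ q * F q * G q := by
  have hf := hF.contDiff
  have hg := hG.contDiff
  have hg0 := contDiff_pderiv hg 0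
  have hg1 := contDiff_pderiv hg 1
  have h0 := integral_pderiv_zero (hf.mul hg0) hL hH
    (hF.periodic_fst.mul (pderiv_periodic hG.periodic_fst 0))
  have h1 := integral_pderiv_one (hf.mul hg1) hL hH
    (hF.periodic_snd.mul (pderiv_periodic hG.periodic_snd 1))
  have hadd := integral_add
    (integrableOn_rect (contDiff_pderiv (hf.mul hg0) 0).continuous 0 L 0 H)
    (integrableOn_rect (contDiff_pderiv (hf.mul hg1) 1).continuous 0 L 0 H)
  rw [h0, h1, add_zero] at hadd
  have hpt : ∀ q, pderiv 0 (fun q => F q * pderiv 0 G q) q +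
      pderiv 1 (fun q => F q * pderiv 1 G q) q =
      (pderiv 0 F q * pderiv 0 G q + pderiv 1 F q * pderiv 1 G q) -
        lam' * (ρ q * F q * G q) := fun q => by
    rw [pderiv_mul hf hg0, pderiv_mul hf hg1]
    linear_combination F q * hG.eq q
  have hc : Continuous fun q => pderiv 0 F q * pderiv 0 G q + pderiv 1 F q * pderiv 1 G q := by
    have := (contDiff_pderiv hf 0).continuous
    have := (contDiff_pderiv hf 1).continuous
    have := hg0.continuous
    have := hg1.continuous
    fun_prop
  have hc' : Continuous fun q => pderiv 0 (fun q => F q * pderiv 0 G q) q +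
      pderiv 1 (fun q => F q * pderiv 1 G q) q :=
    (contDiff_pderiv (hf.mul hg0) 0).continuous.add (contDiff_pderiv (hf.mul hg1) 1).continuous
  -- No regularity of ρ is assumed here; the weighted term is integrable because it is a difference
  -- of two continuous functions.
  have hint : IntegrableOn (fun q => lam' * (ρ q * F q * G q)) (rect 0 L 0 H) := by
    have := (integrableOn_rect hc 0 L 0 H).sub (integrableOn_rect hc' 0 L 0 H)
    refine this.congr (Filter.Eventually.of_forall fun q => ?_)
    simp only [Pi.sub_apply, hpt]
    ring
  have e : (0 : ℝ) = ∫ q in rect 0 L 0 H, ((pderiv 0 F q * pderiv 0 G q +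
      pderiv 1 F q * pderiv 1 G q) - lam' * (ρ q * F q * G q)) :=
    hadd.symm.trans (integral_congr_ae (Filter.Eventually.of_forall hpt))
  rw [integral_sub (integrableOn_rect hc 0 L 0 H) hint, integral_const_mul] at e
  linarith

theorem eq_zero_of_integral_rect_eq_zero {f : ℝ × ℝ → ℝ} (hf : Continuous f) (h0 : ∀ q, 0 ≤ f q)
    {L H : ℝ} (hL : 0 < L) (hH : 0 < H) (hp : Function.Periodic f (L, 0))
    (hp' : Function.Periodic f (0, H)) (hint : ∫ q in rect 0 L 0 H, f q = 0) : f = 0 := by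
  have hae : f =ᵐ[volume.restrict (rect 0 L 0 H)] 0 :=
    (setIntegral_eq_zero_iff_of_nonneg_ae (Filter.Eventually.of_forall h0)
      (integrableOn_rect hf _ _ _ _)).1 hint
  have heq : Set.EqOn f 0 (rect 0 L 0 H) := by
    refine Measure.eqOn_of_ae_eq hae hf.continuousOn continuousOn_const ?_
    rw [rect, interior_prod_eq, closure_prod_eq, interior_Icc, interior_Icc,
      closure_Ioo hL.ne, closure_Ioo hH.ne]
  funext q
  obtain ⟨j, hj⟩ := exists_add_int_mul_mem_Ico hL q.1
  obtain ⟨k, hk⟩ := exists_add_int_mul_mem_Ico hH q.2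
  have h1 := hp.zsmul j q
  have h2 := hp'.zsmul k (q + j • (L, 0))
  rw [← h1, ← h2]
  refine heq ⟨?_, ?_⟩
  · simpa using Set.Ico_subset_Icc_self hj
  · simpa using Set.Ico_subset_Icc_self hk

theorem IsTorusEigenfunction.integral_pos {ρ : ℝ × ℝ → ℝ} {L H lam : ℝ} {F : ℝ × ℝ → ℝ}
    (hF : IsTorusEigenfunction ρ L H lam F) (hρ : Continuous ρ) (hρ0 : ∀ q, 0 < ρ q)
    (hρL : Function.Periodic ρ (L, 0)) (hρH : Function.Periodic ρ (0, H)) (hL : 0 < L)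
    (hH : 0 < H) : 0 < ∫ q in rect 0 L 0 H, ρ q * F q * F q := by
  have hc := hF.contDiff.continuous
  have hnn : ∀ q, 0 ≤ ρ q * F q * F q := fun q => by
    rw [mul_assoc]
    exact mul_nonneg (hρ0 q).le (mul_self_nonneg _)
  refine lt_of_le_of_ne (integral_nonneg hnn) fun h => hF.ne_zero ?_
  have := eq_zero_of_integral_rect_eq_zero (f := fun q => ρ q * F q * F q) (by fun_prop) hnn hL hH
    ((hρL.mul hF.periodic_fst).mul hF.periodic_fst)
    ((hρH.mul hF.periodic_snd).mul hF.periodic_snd) h.symm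
  funext q
  simpa [(hρ0 q).ne'] using congrFun this q

theorem integral_sum_mul_sum {ι : Type*} [Fintype ι] (c : ι → ℝ) (B : ι → ι → ℝ × ℝ → ℝ)
    (hB : ∀ i j, Continuous (B i j)) {L H : ℝ}
    (horth : ∀ i j, i ≠ j → ∫ q in rect 0 L 0 H, B i j q = 0) :
    ∫ q in rect 0 L 0 H, ∑ i, ∑ j, c i * c j * B i j q =
      ∑ i, c i ^ 2 * ∫ q in rect 0 L 0 H, B i i q := by
  classical
  have hi : ∀ i j, IntegrableOn (fun q => c i * c j * B i j q) (rect 0 L 0 H) := fun i j =>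
    (integrableOn_rect (hB i j) _ _ _ _).const_mul _
  rw [integral_finsetSum _ fun i _ => integrable_finsetSum _ fun j _ => hi i j]
  refine Finset.sum_congr rfl fun i _ => ?_
  rw [integral_finsetSum _ fun j _ => hi i j, Finset.sum_eq_single i]
  · rw [integral_const_mul, sq]
  · intro j _ hj
    rw [integral_const_mul, horth i j hj.symm, mul_zero]
  · simp

/-- Distinct eigenvalues make the eigenfunctions orthogonal for both the weighted L² form and the
Dirichlet form. The Rayleigh quotient of a combination is then a weighted average of the eigenvalues
involved. -/
theorem IsTorusEigenfunction.rayleigh {ι : Type*} [Fintype ι] {ρ : ℝ × ℝ → ℝ} {L H Lam : ℝ}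
    (hρ : Continuous ρ) (hρ0 : ∀ q, 0 < ρ q)
    (hρL : Function.Periodic ρ (L, 0)) (hρH : Function.Periodic ρ (0, H)) (hL : 0 < L)
    (hH : 0 < H) {lam : ι → ℝ} (hinj : Function.Injective lam) (hle : ∀ i, lam i ≤ Lam)
    {F : ι → ℝ × ℝ → ℝ} (hF : ∀ i, IsTorusEigenfunction ρ L H (lam i) (F i)) {c : ι → ℝ}
    (hc : c ≠ 0) :
    0 < ∫ q in rect 0 L 0 H, ρ q * (∑ i, c i * F i q) ^ 2 ∧
    ∫ q in rect 0 L 0 H, (pderiv 0 (fun q => ∑ i, c i * F i q) q ^ 2 +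
        pderiv 1 (fun q => ∑ i, c i * F i q) q ^ 2) ≤
      Lam * ∫ q in rect 0 L 0 H, ρ q * (∑ i, c i * F i q) ^ 2 := by
  have hs := fun i => (hF i).contDiff
  have hcF : ∀ i, Continuous (F i) := fun i => (hs i).continuous
  have hc0 : ∀ i, Continuous (pderiv 0 (F i)) := fun i => (contDiff_pderiv (hs i) 0).continuous
  have hc1 : ∀ i, Continuous (pderiv 1 (F i)) := fun i => (contDiff_pderiv (hs i) 1).continuous
  have hgreen := fun i j => (hF i).green (hF j) hL.le hH.le
  have horth : ∀ i j, i ≠ j → ∫ q in rect 0 L 0 H, ρ q * F i q * F j q = 0 := fun i j hij => by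
    have h1 := hgreen i j
    have h2 := hgreen j i
    have h3 : ∫ q in rect 0 L 0 H, ρ q * F j q * F i q = ∫ q in rect 0 L 0 H, ρ q * F i q * F j q :=
      integral_congr_ae (Filter.Eventually.of_forall fun q => mul_right_comm _ _ _)
    have h4 : ∫ q in rect 0 L 0 H, (pderiv 0 (F j) q * pderiv 0 (F i) q +
        pderiv 1 (F j) q * pderiv 1 (F i) q) = ∫ q in rect 0 L 0 H,
        (pderiv 0 (F i) q * pderiv 0 (F j) q + pderiv 1 (F i) q * pderiv 1 (F j) q) :=
      integral_congr_ae (Filter.Eventually.of_forall fun q => by simp only; ring)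
    rw [h3, h4, h1] at h2
    have h5 : lam j - lam i ≠ 0 := sub_ne_zero.2 fun h => hij (hinj h.symm)
    refine (mul_eq_zero.1 (?_ : (lam j - lam i) * _ = 0)).resolve_left h5
    rw [sub_mul, h2, sub_self]
  have hB := integral_sum_mul_sum c (fun i j q => ρ q * F i q * F j q) (L := L) (H := H)
    (fun i j => by fun_prop) horth
  have hD := integral_sum_mul_sum c (fun i j q => pderiv 0 (F i) q * pderiv 0 (F j) q +
    pderiv 1 (F i) q * pderiv 1 (F j) q) (L := L) (H := H) (fun i j => by fun_prop)
    (fun i j hij => by rw [hgreen, horth i j hij, mul_zero])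
  have eB : ∀ q, ρ q * (∑ i, c i * F i q) ^ 2 = ∑ i, ∑ j, c i * c j * (ρ q * F i q * F j q) :=
    fun q => by
      rw [sq, Finset.sum_mul_sum, Finset.mul_sum]
      refine Finset.sum_congr rfl fun i _ => ?_
      rw [Finset.mul_sum]
      exact Finset.sum_congr rfl fun j _ => by ring
  have eD : ∀ q, pderiv 0 (fun q => ∑ i, c i * F i q) q ^ 2 +
      pderiv 1 (fun q => ∑ i, c i * F i q) q ^ 2 = ∑ i, ∑ j, c i * c j *
        (pderiv 0 (F i) q * pderiv 0 (F j) q + pderiv 1 (F i) q * pderiv 1 (F j) q) := fun q => by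
    rw [pderiv_sum _ _ hs, pderiv_sum _ _ hs, sq, sq, Finset.sum_mul_sum, Finset.sum_mul_sum,
      ← Finset.sum_add_distrib]
    refine Finset.sum_congr rfl fun i _ => ?_
    rw [← Finset.sum_add_distrib]
    exact Finset.sum_congr rfl fun j _ => by ring
  have hpos := fun i => (hF i).integral_pos hρ hρ0 hρL hρH hL hH
  simp only [eB, eD, hB, hD, hgreen]
  constructor
  · obtain ⟨i, hi⟩ := Function.ne_iff.1 hc
    exact Finset.sum_pos' (fun i _ => mul_nonneg (sq_nonneg _) (hpos i).le)
      ⟨i, Finset.mem_univ i, mul_pos (sq_pos_of_ne_zero hi) (hpos i)⟩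
  · rw [Finset.mul_sum]
    refine Finset.sum_le_sum fun i _ => ?_
    have := mul_le_mul_of_nonneg_right (hle i) (mul_nonneg (sq_nonneg (c i)) (hpos i).le)
    linarith

/-- One eigenfunction is taken per eigenvalue, so multiplicities play no role. Too many eigenvalues
below `Lam` would allow a combination that violates the Poincaré inequality on a fine grid. -/
theorem finite_torus_eigenvalues {ρ : ℝ × ℝ → ℝ} {L H M : ℝ} (Lam : ℝ)
    (hρ : Continuous ρ) (hρ0 : ∀ q, 0 < ρ q) (hρM : ∀ q, ρ q ≤ M)
    (hρL : Function.Periodic ρ (L, 0)) (hρH : Function.Periodic ρ (0, H)) (hL : 0 < L)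
    (hH : 0 < H) :
    {lam | lam ≤ Lam ∧ ∃ F, IsTorusEigenfunction ρ L H lam F}.Finite := by
  by_contra hinf
  -- The summand 1 ensures N > 1, so that N² > N also exceeds (L² + H²)|Λ|M.
  obtain ⟨N, hN⟩ := exists_nat_gt ((L ^ 2 + H ^ 2) * (|Lam| * M) + 1)
  have hM : 0 < M := (hρ0 0).trans_le (hρM 0)
  have hN1 : (1 : ℝ) < N := lt_of_le_of_lt (by
    have : 0 ≤ (L ^ 2 + H ^ 2) * (|Lam| * M) := by positivity
    linarith) hN
  have hN0 : 0 < N := by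
    have : (0 : ℝ) < N := by linarith
    exact_mod_cast this
  obtain ⟨t, hts, htc⟩ := Set.Infinite.exists_subset_card_eq hinf (N * N + 1)
  have ht : ∀ i : t, i.1 ≤ Lam ∧ ∃ F, IsTorusEigenfunction ρ L H i.1 F := fun i => hts i.2
  choose hle F hF using ht
  have hcF : ∀ i, Continuous (F i) := fun i => (hF i).contDiff.continuous
  -- `T` sends coefficients to the cell integrals of the combination: N² + 1 unknowns against N²
  -- conditions leave a nonzero kernel vector.
  let T : (t → ℝ) →ₗ[ℝ] (Fin N × Fin N → ℝ) :=
    Matrix.mulVecLin (Matrix.of fun k i => ∫ q in cell L H N k.1 k.2, F i q)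
  have hker : LinearMap.ker T ≠ ⊥ := by
    apply LinearMap.ker_ne_bot_of_finrank_lt
    simp [htc]
  obtain ⟨c, hcT, hc⟩ := Submodule.exists_mem_ne_zero_of_ne_bot hker
  obtain ⟨hpos, hray⟩ := IsTorusEigenfunction.rayleigh hρ hρ0 hρL hρH hL hH
    Subtype.val_injective hle hF hc
  set g : ℝ × ℝ → ℝ := fun q => ∑ i, c i * F i q with hg
  have hgs : ContDiff ℝ ∞ g := ContDiff.sum fun i _ => contDiff_const.mul (hF i).contDiff
  have hgc := hgs.continuous
  have hcell : ∀ i < N, ∀ j < N, ∫ q in cell L H N i j, g q = 0 := fun i hi j hj => by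
    have h1 := congrFun (LinearMap.mem_ker.1 hcT) (⟨i, hi⟩, ⟨j, hj⟩)
    have h2 : ∫ q in cell L H N i j, g q = ∑ k, ∫ q in cell L H N i j, c k * F k q :=
      integral_finsetSum _ fun k _ => (integrableOn_rect (hcF k) _ _ _ _).const_mul _
    rw [h2]
    simp only [integral_const_mul]
    simpa [T, Matrix.mulVec, dotProduct, mul_comm] using h1
  have hpoinc := integral_sq_le_of_cells hgs hL hH hN0 hcell
  have hgM : ∫ q in rect 0 L 0 H, ρ q * g q ^ 2 ≤ M * ∫ q in rect 0 L 0 H, g q ^ 2 := by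
    rw [← integral_const_mul]
    exact integral_mono (integrableOn_rect (by fun_prop) _ _ _ _)
      (integrableOn_rect (by fun_prop) _ _ _ _)
      fun q => mul_le_mul_of_nonneg_right (hρM q) (sq_nonneg _)
  set I := ∫ q in rect 0 L 0 H, ρ q * g q ^ 2 with hI
  set J := ∫ q in rect 0 L 0 H, g q ^ 2 with hJ
  have h1 : J ≤ (L ^ 2 + H ^ 2) / N ^ 2 * (|Lam| * I) :=
    hpoinc.trans (mul_le_mul_of_nonneg_left
      (hray.trans (mul_le_mul_of_nonneg_right (le_abs_self _) hpos.le)) (by positivity))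
  have h2 : I ≤ M * ((L ^ 2 + H ^ 2) / N ^ 2 * (|Lam| * I)) :=
    hgM.trans (mul_le_mul_of_nonneg_left h1 hM.le)
  have h3 : (L ^ 2 + H ^ 2) * (|Lam| * M) < N ^ 2 := by nlinarith
  have h4 : M * ((L ^ 2 + H ^ 2) / N ^ 2 * (|Lam| * I)) =
      (L ^ 2 + H ^ 2) * (|Lam| * M) / N ^ 2 * I := by ring
  have h5 : (L ^ 2 + H ^ 2) * (|Lam| * M) / N ^ 2 < 1 := by
    rw [div_lt_one (by positivity)]
    exact h3
  rw [h4] at h2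
  nlinarith

/-! ### A Sturm-Liouville problem by Prüfer's substitution -/

/-- Global solutions of a bounded, globally Lipschitz ordinary differential equation. -/
theorem exists_forall_hasDerivAt_of_lipschitz {f : ℝ → ℝ → ℝ} {K C : NNReal}
    (hlip : ∀ t, LipschitzWith K (f t)) (hcont : ∀ x, Continuous fun t => f t x)
    (hC : ∀ t x, |f t x| ≤ C) (x₀ : ℝ) :
    ∃ α : ℝ → ℝ, α 0 = x₀ ∧ ∀ t, HasDerivAt α (f t (α t)) t := by
  have hloc : ∀ N : ℕ, ∃ α : ℝ → ℝ, α 0 = x₀ ∧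
      ∀ t ∈ Set.Ioo (-(N : ℝ)) N, HasDerivAt α (f t (α t)) t := fun N => by
    -- A field bounded by C cannot carry a solution further than CN in time N, so the ball of radius
    -- CN serves on all of [−N, N].
    have h0 : (0 : ℝ) ∈ Set.Icc (-(N : ℝ)) N := by simp
    have hP : IsPicardLindelof f (⟨0, h0⟩ : Set.Icc (-(N : ℝ)) N) x₀ (C * N) 0 C K :=
      { lipschitzOnWith := fun t _ => (hlip t).lipschitzOnWith
        continuousOn := fun x _ => (hcont x).continuousOn
        norm_le := fun t _ x _ => hC t x
        mul_max_le := by simp }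
    obtain ⟨α, hα0, hα⟩ := hP.exists_eq_forall_mem_Icc_hasDerivWithinAt₀
    exact ⟨α, hα0, fun t ht =>
      (hα t (Set.Ioo_subset_Icc_self ht)).hasDerivAt (Icc_mem_nhds ht.1 ht.2)⟩
  choose α hα0 hα using hloc
  have hagree : ∀ N N' : ℕ, N ≤ N' → Set.EqOn (α N) (α N') (Set.Ioo (-(N : ℝ)) N) :=
    fun N N' hNN' x hx => by
    have hNN : (N : ℝ) ≤ N' := by exact_mod_cast hNN'
    have hN0 : (0 : ℝ) < N := by linarith [hx.1, hx.2]
    refine ODE_solution_unique_of_mem_Ioo (v := f) (s := fun _ => Set.univ) (K := K) (t₀ := 0)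
      (fun t _ => (hlip t).lipschitzOnWith) ⟨by linarith, hN0⟩
      (fun t ht => ⟨hα N t ht, trivial⟩)
      (fun t ht => ⟨hα N' t ⟨by linarith [ht.1], by linarith [ht.2]⟩, trivial⟩)
      (by rw [hα0, hα0]) hx
  have hmem : ∀ x : ℝ, x ∈ Set.Ioo (-((⌈|x|⌉₊ + 1 : ℕ) : ℝ)) (⌈|x|⌉₊ + 1 : ℕ) := fun x => by
    have h := Nat.le_ceil |x|
    rw [Set.mem_Ioo, ← abs_lt]
    push_cast
    linarith
  have heq : ∀ (N : ℕ) (x : ℝ), x ∈ Set.Ioo (-(N : ℝ)) N → α (⌈|x|⌉₊ + 1) x = α N x :=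
    fun N x hx => by
    rcases le_total (⌈|x|⌉₊ + 1) N with h | h
    · exact hagree _ _ h (hmem x)
    · exact (hagree _ _ h hx).symm
  -- The local solutions agree by uniqueness; the extra 1 in the index puts x in the open interval,
  -- where a two-sided derivative is available.
  refine ⟨fun x => α (⌈|x|⌉₊ + 1) x, hα0 _, fun t => ?_⟩
  refine (hα _ t (hmem t)).congr_of_eventuallyEq ?_
  filter_upwards [Ioo_mem_nhds (hmem t).1 (hmem t).2] with x hx
  exact heq _ x hx

/-- The right-hand side of the Prüfer equation of `u_xx + lam ρ u = 0`. -/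
noncomputable def prufer (ρ : ℝ → ℝ) (lam x θ : ℝ) : ℝ :=
  Real.sin θ ^ 2 + lam * ρ x * Real.cos θ ^ 2

theorem abs_prufer_le {ρ : ℝ → ℝ} {M : NNReal} (hρ : ∀ x, |ρ x| ≤ M) (lam x θ : ℝ) :
    |prufer ρ lam x θ| ≤ (1 + ‖lam‖₊ * M : NNReal) := by
  have hs := Real.sin_sq_le_one θ
  have hc := Real.cos_sq_le_one θ
  have hs0 := sq_nonneg (Real.sin θ)
  have hc0 := sq_nonneg (Real.cos θ)
  refine (abs_add_le _ _).trans ?_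
  push_cast
  rw [abs_mul, abs_mul, abs_of_nonneg hs0, abs_of_nonneg hc0, Real.norm_eq_abs]
  refine add_le_add hs ?_
  have h1 : |lam| * |ρ x| ≤ |lam| * M := mul_le_mul_of_nonneg_left (hρ x) (abs_nonneg _)
  exact (mul_le_of_le_one_right (by positivity) hc).trans h1

/-- With cos² = 1 − sin², the difference of two values is (1 − λρ)(sin² a − sin² b), and sin² a −
sin² b = sin(a − b) sin(a + b). -/
theorem lipschitzWith_prufer {ρ : ℝ → ℝ} {M : NNReal} (hρ : ∀ x, |ρ x| ≤ M) (lam x : ℝ) :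
    LipschitzWith (1 + ‖lam‖₊ * M) (prufer ρ lam x) := by
  refine LipschitzWith.of_dist_le_mul fun a b => ?_
  have e : prufer ρ lam x a - prufer ρ lam x b =
      (1 - lam * ρ x) * (Real.sin (a - b) * Real.sin (a + b)) := by
    rw [prufer, prufer, Real.sin_sub, Real.sin_add, Real.cos_sq', Real.cos_sq']
    linear_combination (-(1 - lam * ρ x)) * (Real.sin a ^ 2 * Real.cos_sq' b -
      Real.sin b ^ 2 * Real.cos_sq' a)
  rw [Real.dist_eq, Real.dist_eq, e, abs_mul, abs_mul]
  have h1 : |1 - lam * ρ x| ≤ 1 + |lam| * M := by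
    refine (abs_sub _ _).trans ?_
    rw [abs_one, abs_mul]
    gcongr
    exact hρ x
  have h2 : |Real.sin (a - b)| ≤ |a - b| := Real.abs_sin_le_abs
  have h3 : |Real.sin (a + b)| ≤ 1 := Real.abs_sin_le_one _
  push_cast
  rw [Real.norm_eq_abs]
  refine mul_le_mul h1 ?_ (by positivity) (by positivity)
  exact (mul_le_of_le_one_right (abs_nonneg _) h3).trans h2

/-- The Prüfer angle depends continuously on the parameter. -/
theorem continuous_prufer_angle {ρ : ℝ → ℝ} {M : NNReal} (hρ : ∀ x, |ρ x| ≤ M)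
    {θ : ℝ → ℝ → ℝ} (h0 : ∀ lam, θ lam 0 = 0)
    (hθ : ∀ lam x, HasDerivAt (θ lam) (prufer ρ lam x (θ lam x)) x) {A : ℝ} (hA : 0 ≤ A) :
    Continuous fun lam => θ lam A := by
  rw [continuous_iff_continuousAt]
  intro lam
  -- The angle for `mu` is an approximate trajectory of the equation for `lam`, with defect at most
  -- |mu − lam| M. Grönwall's bound then tends to 0 as `mu` tends to `lam`.
  have hb : ∀ mu, dist (θ mu A) (θ lam A) ≤
      gronwallBound 0 (1 + ‖lam‖₊ * M : NNReal) (|mu - lam| * M + 0) (A - 0) := fun mu => by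
    refine dist_le_of_approx_trajectories_ODE (v := prufer ρ lam) (δ := 0) (a := 0) (b := A)
      (fun t => lipschitzWith_prufer hρ lam t)
      (fun t _ => (hθ mu t).continuousAt.continuousWithinAt)
      (fun t _ => (hθ mu t).hasDerivWithinAt) (fun t _ => ?_)
      (fun t _ => (hθ lam t).continuousAt.continuousWithinAt)
      (fun t _ => (hθ lam t).hasDerivWithinAt) (fun t _ => by rw [dist_self])
      (by rw [h0, h0, dist_self]) A ⟨hA, le_rfl⟩
    rw [Real.dist_eq, show prufer ρ mu t (θ mu t) - prufer ρ lam t (θ mu t) =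
      (mu - lam) * ρ t * Real.cos (θ mu t) ^ 2 by rw [prufer, prufer]; ring, abs_mul, abs_mul]
    rw [abs_of_nonneg (sq_nonneg (Real.cos (θ mu t)))]
    refine (mul_le_of_le_one_right (by positivity) (Real.cos_sq_le_one _)).trans ?_
    exact mul_le_mul_of_nonneg_left (hρ t) (abs_nonneg _)
  refine tendsto_iff_dist_tendsto_zero.2 (squeeze_zero (fun _ => dist_nonneg) hb ?_)
  have hc : Continuous fun mu : ℝ =>
      gronwallBound 0 (1 + ‖lam‖₊ * M : NNReal) (|mu - lam| * M + 0) (A - 0) :=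
    (gronwallBound_continuous_ε 0 _ (A - 0)).comp (by fun_prop)
  have := hc.tendsto lam
  simpa [gronwallBound_ε0_δ0] using this

/-- The solution of `u_xx + lam ρ u = 0` with a given Prüfer angle. -/
theorem exists_solution_of_prufer_angle {ρ : ℝ → ℝ} (hρ : Continuous ρ) {lam : ℝ} {θ : ℝ → ℝ}
    (hθ : ∀ x, HasDerivAt θ (prufer ρ lam x (θ x)) x) :
    ∃ R u w : ℝ → ℝ, (∀ x, 0 < R x) ∧ (∀ x, u x = R x * Real.cos (θ x)) ∧
      (∀ x, w x = -(R x * Real.sin (θ x))) ∧ (∀ x, HasDerivAt u (w x) x) ∧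
      ∀ x, HasDerivAt w (-(lam * ρ x) * u x) x := by
  have hcθ : Continuous θ := continuous_iff_continuousAt.2 fun x => (hθ x).continuousAt
  -- `h` is the logarithmic derivative of the radius R in u = R cos θ, u' = −R sin θ.
  set h : ℝ → ℝ := fun x => Real.sin (θ x) * Real.cos (θ x) * (lam * ρ x - 1) with hh
  have hch : Continuous h := by fun_prop
  have hI : ∀ x, HasDerivAt (fun x => ∫ t in (0 : ℝ)..x, h t) (h x) x := fun x =>
    intervalIntegral.integral_hasDerivAt_right (hch.intervalIntegrable _ _)
      (hch.stronglyMeasurableAtFilter _ _) hch.continuousAt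
  have hR : ∀ x, HasDerivAt (fun x => Real.exp (∫ t in (0 : ℝ)..x, h t)) _ x := fun x => (hI x).exp
  refine ⟨fun x => Real.exp (∫ t in (0 : ℝ)..x, h t), _, _, fun x => Real.exp_pos _, fun x => rfl,
    fun x => rfl, fun x => ?_, fun x => ?_⟩
  · refine ((hR x).mul (hθ x).cos).congr_deriv ?_
    simp only [hh, prufer]
    linear_combination (-(Real.exp (∫ t in (0 : ℝ)..x, h t) * Real.sin (θ x))) *
      Real.sin_sq_add_cos_sq (θ x)
  · refine ((hR x).mul (hθ x).sin).neg.congr_deriv ?_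
    simp only [hh, prufer]
    linear_combination (-(Real.exp (∫ t in (0 : ℝ)..x, h t) * Real.cos (θ x)) * lam * ρ x) *
      Real.sin_sq_add_cos_sq (θ x)

theorem linear_ode_unique {Q : ℝ → ℝ} {C : NNReal} (hQ : ∀ x, |Q x| ≤ C) {u₁ w₁ u₂ w₂ : ℝ → ℝ}
    (hu₁ : ∀ x, HasDerivAt u₁ (w₁ x) x) (hw₁ : ∀ x, HasDerivAt w₁ (-(Q x) * u₁ x) x)
    (hu₂ : ∀ x, HasDerivAt u₂ (w₂ x) x) (hw₂ : ∀ x, HasDerivAt w₂ (-(Q x) * u₂ x) x) {x₀ : ℝ}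
    (hu : u₁ x₀ = u₂ x₀) (hw : w₁ x₀ = w₂ x₀) : u₁ = u₂ ∧ w₁ = w₂ := by
  have hlip : ∀ t, LipschitzWith (max 1 C) fun z : ℝ × ℝ => (z.2, -(Q t) * z.1) := fun t => by
    refine LipschitzWith.prodMk (LipschitzWith.prod_snd) ?_
    refine LipschitzWith.of_dist_le_mul fun a b => ?_
    rw [Real.dist_eq, ← mul_sub, abs_mul, abs_neg, Prod.dist_eq]
    exact mul_le_mul (hQ t) (le_max_left _ _) (abs_nonneg _) C.2
  have h := ODE_solution_unique_univ (f := fun x => (u₁ x, w₁ x)) (g := fun x => (u₂ x, w₂ x))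
    (v := fun t z => (z.2, -(Q t) * z.1)) (s := fun _ => Set.univ) (t₀ := x₀)
    (fun t => (hlip t).lipschitzOnWith) (fun t => ⟨(hu₁ t).prodMk (hw₁ t), trivial⟩)
    (fun t => ⟨(hu₂ t).prodMk (hw₂ t), trivial⟩) (by simp only [hu, hw])
  exact ⟨funext fun x => congrArg Prod.fst (congrFun h x),
    funext fun x => congrArg Prod.snd (congrFun h x)⟩

theorem contDiff_of_linear_ode {Q : ℝ → ℝ} (hQ : ContDiff ℝ ∞ Q) {u w : ℝ → ℝ}
    (hu : ∀ x, HasDerivAt u (w x) x) (hw : ∀ x, HasDerivAt w (-(Q x) * u x) x) :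
    ContDiff ℝ ∞ u := by
  have h : ∀ k : ℕ, ContDiff ℝ k u ∧ ContDiff ℝ k w := fun k => by
    induction k with
    | zero =>
      exact ⟨contDiff_zero.2 (continuous_iff_continuousAt.2 fun x => (hu x).continuousAt),
        contDiff_zero.2 (continuous_iff_continuousAt.2 fun x => (hw x).continuousAt)⟩
    | succ k ih =>
      rw [show ((k + 1 : ℕ) : WithTop ℕ∞) = (k : WithTop ℕ∞) + 1 by push_cast; rfl,
        contDiff_succ_iff_deriv, contDiff_succ_iff_deriv]
      refine ⟨⟨fun x => (hu x).differentiableAt, by simp, ?_⟩,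
        ⟨fun x => (hw x).differentiableAt, by simp, ?_⟩⟩
      · rw [show deriv u = w from funext fun x => (hu x).deriv]
        exact ih.2
      · rw [show deriv w = fun x => -(Q x) * u x from funext fun x => (hw x).deriv]
        exact (hQ.of_le (by exact_mod_cast le_top)).neg.mul ih.1
  exact contDiff_infty.2 fun k => (h k).1

/-- Sturm comparison: the Prüfer angle passes `π / 2` before the first zero of a slower
solution. -/
theorem pi_div_two_lt_prufer_angle {ρ : ℝ → ℝ} (hρ : Continuous ρ) (hρ0 : ∀ x, 0 < ρ x)
    {lam A : ℝ} (hlam : 0 < lam) (hA : 0 < A) {θ : ℝ → ℝ} (h0 : θ 0 = 0)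
    (hθ : ∀ x, HasDerivAt θ (prufer ρ lam x (θ x)) x) {k v v' : ℝ → ℝ}
    (hv : ∀ x, HasDerivAt v (v' x) x) (hv' : ∀ x, HasDerivAt v' (-(k x) * v x) x)
    (hv'0 : v' 0 = 0) (hvA : v A = 0) (hvpos : ∀ x ∈ Set.Ioo 0 A, 0 < v x) (hv'A : v' A < 0)
    (hk : ∀ x ∈ Set.Ioo 0 A, k x < lam * ρ x) : Real.pi / 2 < θ A := by
  by_contra! hle
  obtain ⟨R, u, w, hR, hu, hw, hdu, hdw⟩ := exists_solution_of_prufer_angle hρ hθ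
  have hmono : StrictMono θ := strictMono_of_hasDerivAt_pos hθ fun x => by
    rw [prufer]
    rcases eq_or_ne (Real.sin (θ x)) 0 with h | h
    · have : Real.cos (θ x) ^ 2 = 1 := by rw [Real.cos_sq', h]; ring
      rw [h, this]
      have := mul_pos hlam (hρ0 x)
      linarith
    · have h1 := sq_pos_of_ne_zero h
      have h2 := mul_nonneg (mul_pos hlam (hρ0 x)).le (sq_nonneg (Real.cos (θ x)))
      linarith
  have hpi := Real.pi_pos
  have hupos : ∀ x ∈ Set.Ioo 0 A, 0 < u x := fun x hx => by
    rw [hu]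
    refine mul_pos (hR x) (Real.cos_pos_of_mem_Ioo ⟨?_, (hmono hx.2).trans_le hle⟩)
    have := hmono hx.1
    linarith
  have huA : 0 ≤ u A := by
    rw [hu]
    refine mul_nonneg (hR A).le (Real.cos_nonneg_of_mem_Icc ⟨?_, hle⟩)
    have := hmono hA
    linarith
  -- If the angle stayed at most π/2, u would be positive on (0, A) and the Wronskian u'v − uv'
  -- would strictly decrease. It vanishes at 0 and equals −u(A)v'(A) ≥ 0 at A, a contradiction.
  have hW : ∀ x, HasDerivAt (fun x => w x * v x - u x * v' x)
      (-((lam * ρ x - k x) * (u x * v x))) x := fun x =>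
    (((hdw x).mul (hv x)).sub ((hdu x).mul (hv' x))).congr_deriv (by ring)
  have hanti : StrictAntiOn (fun x => w x * v x - u x * v' x) (Set.Icc 0 A) := by
    refine strictAntiOn_of_deriv_neg (convex_Icc 0 A)
      (fun x _ => (hW x).continuousAt.continuousWithinAt) fun x hx => ?_
    rw [interior_Icc] at hx
    rw [(hW x).deriv]
    exact neg_neg_of_pos (mul_pos (sub_pos.2 (hk x hx)) (mul_pos (hupos x hx) (hvpos x hx)))
  have h1 := hanti ⟨le_rfl, hA.le⟩ ⟨hA.le, le_rfl⟩ hA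
  simp only [hv'0, hvA, hw 0, h0, Real.sin_zero, mul_zero, neg_zero, zero_mul, sub_zero,
    zero_sub] at h1
  nlinarith [mul_nonneg huA (neg_pos.2 hv'A).le]

/-- A periodic even eigenfunction of `u_xx + lam ρ u = 0` with `lam` below a given bound. -/
theorem exists_even_periodic_eigenfunction {ρ : ℝ → ℝ} (hρ : ContDiff ℝ ∞ ρ) (hρ0 : ∀ x, 0 < ρ x)
    {M : NNReal} (hρM : ∀ x, |ρ x| ≤ M) {sig A : ℝ} (hsig : 0 < sig) (hA : 0 < A)
    (heven : ∀ x, ρ (-x) = ρ x) (hsym : ∀ x, ρ (2 * A - x) = ρ x) {k v v' : ℝ → ℝ}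
    (hv : ∀ x, HasDerivAt v (v' x) x) (hv' : ∀ x, HasDerivAt v' (-(k x) * v x) x)
    (hv'0 : v' 0 = 0) (hvA : v A = 0) (hvpos : ∀ x ∈ Set.Ioo 0 A, 0 < v x) (hv'A : v' A < 0)
    (hk : ∀ x ∈ Set.Ioo 0 A, k x < sig * ρ x) :
    ∃ lam, 0 < lam ∧ lam < sig ∧ ∃ u w : ℝ → ℝ, u ≠ 0 ∧ ContDiff ℝ ∞ u ∧
      (∀ x, HasDerivAt u (w x) x) ∧ (∀ x, HasDerivAt w (-(lam * ρ x) * u x) x) ∧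
      (∀ x, u (-x) = u x) ∧ ∀ x, u (x + 4 * A) = u x := by
  have hex : ∀ lam : ℝ, ∃ θ : ℝ → ℝ, θ 0 = 0 ∧ ∀ x, HasDerivAt θ (prufer ρ lam x (θ x)) x :=
    fun lam => by
    have hc := hρ.continuous
    refine exists_forall_hasDerivAt_of_lipschitz (lipschitzWith_prufer hρM lam) (fun θ => ?_)
      (abs_prufer_le hρM lam) 0
    unfold prufer
    fun_prop
  choose θ h0 hθ using hex
  have hcont := continuous_prufer_angle hρM h0 hθ hA.le
  have hpi := Real.pi_pos
  -- For parameter 0 the equation is θ' = sin² θ, which the zero function solves.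
  have hθ0 : θ 0 A = 0 := by
    have h := ODE_solution_unique_univ (f := θ 0) (g := fun _ => 0) (v := prufer ρ 0)
      (s := fun _ => Set.univ) (t₀ := 0)
      (fun t => (lipschitzWith_prufer hρM 0 t).lipschitzOnWith)
      (fun t => ⟨hθ 0 t, trivial⟩)
      (fun t => ⟨by simpa [prufer] using hasDerivAt_const t (0 : ℝ), trivial⟩) (h0 0)
    rw [h]
  have hθs := pi_div_two_lt_prufer_angle hρ.continuous hρ0 hsig hA (h0 sig) (hθ sig) hv hv' hv'0
    hvA hvpos hv'A hk
  -- An angle of exactly π/2 at A means u(A) = 0; the strict inequalities at both ends place the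
  -- parameter in the open interval.
  obtain ⟨lam, hlam, hval⟩ := intermediate_value_Icc hsig.le hcont.continuousOn
    (show Real.pi / 2 ∈ Set.Icc (θ 0 A) (θ sig A) from ⟨by rw [hθ0]; positivity, hθs.le⟩)
  simp only at hval
  have hlam0 : 0 < lam := lt_of_le_of_ne hlam.1 fun h => by
    rw [← h, hθ0] at hval
    linarith
  have hlams : lam < sig := lt_of_le_of_ne hlam.2 fun h => by
    rw [h] at hval
    linarith
  obtain ⟨R, u, w, hR, hu, hw, hdu, hdw⟩ := exists_solution_of_prufer_angle hρ.continuous (hθ lam)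
  have hQ : ∀ x, |lam * ρ x| ≤ (‖lam‖₊ * M : NNReal) := fun x => by
    rw [abs_mul]
    push_cast
    exact mul_le_mul_of_nonneg_left (hρM x) (abs_nonneg _)
  have huneg : ∀ x, u (-x) = u x := fun x => by
    have h1 : ∀ x, HasDerivAt (fun x => u (-x)) (-w (-x)) x := fun x =>
      ((hdu (-x)).comp x (hasDerivAt_neg x)).congr_deriv (by ring)
    have h2 : ∀ x, HasDerivAt (fun x => -w (-x)) (-(lam * ρ x) * u (-x)) x := fun x =>
      ((hdw (-x)).comp x (hasDerivAt_neg x)).neg.congr_deriv (by rw [heven]; ring)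
    have h3 := (linear_ode_unique hQ h1 h2 hdu hdw (x₀ := 0) (by simp)
      (by simp [hw, h0])).1
    exact congrFun h3 x
  have huA : u A = 0 := by rw [hu, hval, Real.cos_pi_div_two, mul_zero]
  -- Both sides solve the same equation, as ρ is symmetric about A, and both have value 0 and the
  -- same slope at A. Together with evenness this gives u(x + 2A) = −u(x), hence period 4A.
  have hurefl : ∀ x, -u (2 * A - x) = u x := fun x => by
    have h1 : ∀ x, HasDerivAt (fun x => -u (2 * A - x)) (w (2 * A - x)) x := fun x =>
      ((hdu (2 * A - x)).comp x ((hasDerivAt_id x).const_sub (2 * A))).neg.congr_deriv (by ring)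
    have h2 : ∀ x, HasDerivAt (fun x => w (2 * A - x)) (-(lam * ρ x) * -u (2 * A - x)) x :=
      fun x => ((hdw (2 * A - x)).comp x ((hasDerivAt_id x).const_sub (2 * A))).congr_deriv
        (by rw [hsym]; ring)
    have h3 := (linear_ode_unique hQ h1 h2 hdu hdw (x₀ := A)
      (by rw [show 2 * A - A = A by ring, huA, neg_zero])
      (by rw [show 2 * A - A = A by ring])).1
    exact congrFun h3 x
  have hshift : ∀ x, u (x + 2 * A) = -u x := fun x => by
    rw [← hurefl (x + 2 * A), show 2 * A - (x + 2 * A) = -x by ring, huneg]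
  refine ⟨lam, hlam0, hlams, u, w, ?_, contDiff_of_linear_ode (contDiff_const.mul hρ) hdu hdw,
    hdu, hdw, huneg, fun x => ?_⟩
  · intro h
    have h1 := congrFun h 0
    rw [hu, h0, Real.cos_zero, mul_one] at h1
    exact (hR 0).ne' h1
  · rw [show x + 4 * A = x + 2 * A + 2 * A by ring, hshift, hshift, neg_neg]

/-! ### The first eigenvalue of `K_{n,m}` -/

/-- The square of the glide is a pure translation in y by twice the glide length, so every
eigenfunction lifts to the torus with periods 4K/r and that length. -/
theorem finite_kleinPositiveEigenvalues_le {n m : ℤ} (hm : 0 < m) (hmn : m < n) (Lam : ℝ) :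
    {lam | lam ∈ kleinPositiveEigenvalues n m ∧ lam ≤ Lam}.Finite := by
  have hA := quarterPeriod_pos hm hmn
  have hc := glideLength_pos hm hmn
  have hcont := (contDiff_conformalFactor hm hmn).continuous
  refine (finite_torus_eigenvalues (ρ := fun q => conformalFactor n m q.1)
    (L := 4 * quarterPeriod n m) (H := 2 * glideLength n m) Lam (by fun_prop)
    (fun q => conformalFactor_pos hm hmn q.1) (fun q => conformalFactor_le q.1) (fun q => ?_)
    (fun q => by simp) (by positivity) (by positivity)).subset ?_
  · have h := (conformalFactor_periodic hm hmn).nsmul 2 q.1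
    rw [nsmul_eq_mul, Nat.cast_ofNat, ← mul_assoc] at h
    norm_num at h
    exact h
  · rintro lam ⟨hlam, hle⟩
    obtain ⟨-, F, hF0, hF, hx, hy, heq⟩ := (mem_kleinPositiveEigenvalues hm hmn).1 hlam
    refine ⟨hle, F, hF0, hF, fun ⟨x, y⟩ => ?_, fun ⟨x, y⟩ => ?_, heq⟩
    · simpa using hx x y
    · have h1 := hy (-x) (y + glideLength n m)
      rw [hy x y, neg_neg, add_assoc, ← two_mul] at h1
      simpa using h1

theorem pderiv_comp_fst {u w : ℝ → ℝ} (hu : ∀ x, HasDerivAt u (w x) x) :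
    pderiv 0 (fun q : ℝ × ℝ => u q.1) = (fun q => w q.1) ∧
      pderiv 1 (fun q : ℝ × ℝ => u q.1) = fun _ => 0 := by
  have h : ∀ q : ℝ × ℝ, HasFDerivAt (fun q : ℝ × ℝ => u q.1) _ q := fun q =>
    (hu q.1).hasFDerivAt.comp q (hasFDerivAt_fst (𝕜 := ℝ) (p := q))
  constructor <;> funext q <;> rw [pderiv, (h q).fderiv] <;> simp [coordVec]

/-- A function of x alone is invariant under the glide exactly when it is even. The comparison
function is cn(rx), with potential r²(1 − 2p² sn²) and first positive zero at the quarter period. -/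
theorem exists_kleinPositiveEigenvalue_lt {n m : ℤ} (hm : 0 < m) (hmn : m < n) :
    ∃ lam ∈ kleinPositiveEigenvalues n m, lam < 2 - (m : ℝ) ^ 2 / (n * (n + m)) := by
  have hm' : (0 : ℝ) < m := by exact_mod_cast hm
  have hmn' : (m : ℝ) < n := by exact_mod_cast hmn
  have hn' : (0 : ℝ) < n := hm'.trans hmn'
  have hA := quarterPeriod_pos hm hmn
  have hp0 := modulus_nonneg n m
  have hp1 := modulus_lt_one hm hmn
  have hr := paramR_pos hm hmn
  have hrA := paramR_mul_quarterPeriod hm hmn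
  have hpsq := modulus_sq hm hmn
  have hppos := modulus_pos hm hmn
  have hρ := contDiff_conformalFactor hm hmn
  have hρ0 := conformalFactor_pos hm hmn
  have hKm : jacobiAm (modulus n m) (ellipticK (modulus n m)) = Real.pi / 2 :=
    jacobiAm_ellipticK hp0 hp1
  set p := modulus n m with hp
  set r := paramR n m with hrdef
  set A := quarterPeriod n m with hAdef
  set M : ℝ := r ^ 2 * (((n : ℝ) + m) / (n + 2 * m)) with hM
  have hin : ∀ x, HasDerivAt (fun x => r * x) r x := fun x => by
    simpa using (hasDerivAt_id x).const_mul r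
  have hv : ∀ x, HasDerivAt (fun x => jacobiCn p (r * x))
      (-jacobiSn p (r * x) * jacobiDn p (r * x) * r) x := fun x =>
    (hasDerivAt_jacobiCn hp0 hp1 (r * x)).comp x (hin x)
  have hv' : ∀ x, HasDerivAt (fun x => -jacobiSn p (r * x) * jacobiDn p (r * x) * r)
      (-(r ^ 2 * (1 - 2 * p ^ 2 * jacobiSn p (r * x) ^ 2)) * jacobiCn p (r * x)) x := fun x => by
    have h1 := (hasDerivAt_jacobiSn hp0 hp1 (r * x)).comp x (hin x)
    have h2 := (hasDerivAt_jacobiDn hp0 hp1 (r * x)).comp x (hin x)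
    refine ((h1.neg.mul h2).mul_const r).congr_deriv ?_
    simp only [Pi.neg_apply, Function.comp_apply]
    linear_combination (-(r ^ 2 * jacobiCn p (r * x))) * jacobiDn_sq hp0 hp1 (r * x)
  have hlt1 : (m : ℝ) ^ 2 / (n * (n + m)) < 1 := by
    rw [div_lt_one (by positivity)]
    nlinarith
  obtain ⟨lam, hlam, hlt, u, w, hu0, hus, hdu, hdw, huneg, huper⟩ :=
    exists_even_periodic_eigenfunction hρ hρ0 (M := ⟨M, by positivity⟩)
      (fun x => by rw [abs_of_pos (hρ0 x)]; exact conformalFactor_le x)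
      (sig := 2 - (m : ℝ) ^ 2 / (n * (n + m))) (by linarith) hA (conformalFactor_neg hm hmn)
      (conformalFactor_two_mul_sub hm hmn) hv hv'
      (by simp [jacobiSn, jacobiAm_zero hp0 hp1])
      (by simp [hrA, jacobiCn, hKm])
      (fun x hx => jacobiCn_pos_of_mem_Ico hp0 hp1
        ⟨(mul_pos hr hx.1).le, by rw [← hrA]; exact mul_lt_mul_of_pos_left hx.2 hr⟩)
      (by
        have h1 := jacobiDn_pos hp0 hp1 (r * A)
        have h2 : jacobiSn p (r * A) = 1 := by rw [hrA, jacobiSn, hKm, Real.sin_pi_div_two]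
        rw [h2]
        nlinarith [mul_pos h1 hr])
      (fun x _ => by
        -- The bound σ satisfies σ(n+m)/(n+2m) = 1 + p², so the constant terms leave r²p² and the
        -- sn² terms leave r²p²(2 − σ) sn².
        have h1 : (2 - (m : ℝ) ^ 2 / (n * (n + m))) * conformalFactor n m x -
            r ^ 2 * (1 - 2 * p ^ 2 * jacobiSn p (r * x) ^ 2) =
            r ^ 2 * p ^ 2 * (1 + (m : ℝ) ^ 2 / (n * (n + m)) * jacobiSn p (r * x) ^ 2) := by
          rw [conformalFactor, ← hp, ← hrdef, hpsq]
          field_simp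
          ring
        have h2 : 0 < r ^ 2 * p ^ 2 *
            (1 + (m : ℝ) ^ 2 / (n * (n + m)) * jacobiSn p (r * x) ^ 2) := by positivity
        linarith)
  refine ⟨lam, (mem_kleinPositiveEigenvalues hm hmn).2 ⟨hlam, fun q => u q.1, fun h => hu0 ?_,
    hus.comp contDiff_fst, fun x y => huper x, fun x y => huneg x, fun q => ?_⟩, hlt⟩
  · funext x
    exact congrFun h (x, 0)
  · have h0 : pderiv 1 (fun _ : ℝ × ℝ => (0 : ℝ)) = fun _ => 0 :=
      (pderiv_comp_fst fun x => hasDerivAt_const x (0 : ℝ)).2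
    rw [(pderiv_comp_fst hdu).1, (pderiv_comp_fst hdu).2, (pderiv_comp_fst hdw).1, h0]
    ring

end KleinCP2

theorem proposition5p3 (n m : ℤ) (hm : 0 < m) (hmn : m < n) (hcop : IsCoprime n m)
    (hodd : Odd n) (hdvd : 6 ∣ 2 * n + m) :
    (∃ lam₁ : ℝ, IsLeast (KleinCP2.kleinPositiveEigenvalues n m) lam₁ ∧
      lam₁ < 2 - 1 / (2 * KleinCP2.paramB n m ^ 3) ∧
      2 - 1 / (2 * KleinCP2.paramB n m ^ 3) = 2 - (m : ℝ) ^ 2 / (n * (n + m))) ∧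
    KleinCP2.kleinArea n m = ENNReal.ofReal
      (4 * Real.pi * √(n : ℝ) / (3 * √((n : ℝ) + 2 * m)) *
        (((n : ℝ) + 2 * m) * KleinCP2.ellipticE (KleinCP2.modulus n m) -
          m * KleinCP2.ellipticK (KleinCP2.modulus n m))) := by
  have hm' : (0 : ℝ) < m := by exact_mod_cast hm
  have hmn' : (m : ℝ) < n := by exact_mod_cast hmn
  have hn' : (0 : ℝ) < n := hm'.trans hmn'
  refine ⟨?_, KleinCP2.kleinArea_eq hm hmn⟩
  have hb : 2 - 1 / (2 * KleinCP2.paramB n m ^ 3) = 2 - (m : ℝ) ^ 2 / (n * (n + m)) := by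
    rw [KleinCP2.paramB_cube hm hmn]
    field_simp
  obtain ⟨lam, hlam, hlt⟩ := KleinCP2.exists_kleinPositiveEigenvalue_lt hm hmn
  -- The eigenvalues up to the one just found form a finite nonempty set; its minimum is least among
  -- all of them, since any other eigenvalue lies above `lam`.
  obtain ⟨lam₁, ⟨h₁, hle⟩, hmin⟩ := Set.exists_min_image _ id
    (KleinCP2.finite_kleinPositiveEigenvalues_le hm hmn lam) ⟨lam, hlam, le_rfl⟩
  refine ⟨lam₁, ⟨h₁, fun mu hmu => ?_⟩, ?_, hb⟩
  · rcases le_total mu lam with h | h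
    · exact hmin mu ⟨hmu, h⟩
    · exact hle.trans h
  · rw [hb]
    exact hle.trans_lt hlt
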